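/- **Conventions.** A *topological graph* $E=(E^0,E^1,r,s)$ consists of second countable locally compact Hausdorff spaces $E^0$, $E^1$, a continuous map $r\colon E^1\to E^0$ and a local homeomorphism $s\colon E^1\to E^0$. For a continuous map $\psi\colon X\to Y$ of locally compact Hausdorff spaces, let $Y_{\psi\text{-src}}=Y\setminus\overline{\psi(X)}$, let $Y_{\psi\text{-fin}}$ be the set of $y\in Y$ having a precompact open neighbourhood $U$ with $\psi^{-1}(\overline U)$ compact, and let $Y_{\psi\text{-sing}}=Y\setminus\bigl(Y_{\psi\text{-fin}}\setminus\overline{Y_{\psi\text{-src}}}\bigr)$; write $E^0_{\text{sing}}=E^0_{r\text{-sing}}$. An *in-split* of $E$ is a triple $I=(\alpha,E^0_I,\psi)$ of a locally compact Hausdorff space $E_I^0$, a continuous map $\psi\colon E^1\to E^0_I$ and a continuous proper surjection $\alpha\colon E^0_I\to E^0$ which restricts to a homeomorphism from $E^0_{I,\psi\text{-sing}}$ onto $E^0_{\text{sing}}$, such that $\alpha\circ\psi=r$. The *in-split graph* $E_I$ has vertex space $E^0_I$, edge space $E^1_I=\{(e,v)\in E^1\times E^0_I: s(e)=\alpha(v)\}$,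 $r_I(e,v)=\psi(e)$ and $s_I(e,v)=v$. The *graph correspondence* $(\phi,X(E))$ is the $C_0(E^0)$-correspondence obtained by completing $C_c(E^1)$ with $$(x\cdot a)(e)=x(e)a(s(e)),\qquad (\phi(a)x)(e)=a(r(e))x(e),\qquad (x\mid y)(v)=\sum_{s(e)=v}\overline{x(e)}\,y(e);$$ the correspondence $(\phi_I,X(E_I))$ over $C_0(E_I^0)$ is defined by the same formulas. For a right Hilbert $A$-module $X$ and a $*$-homomorphism $\psi\colon B\to \mathrm{End}_A(X)$ into the adjointable operators, put $J_\psi=\psi^{-1}(\mathrm{End}^0_A(X))\cap\ker(\psi)^\perp$, where $\mathrm{End}^0_A(X)$ denotes the generalised compact operators and $\ker(\psi)^\perp=\{b\in B: b\ker(\psi)=0\}$. An *in-split* of a nondegenerate correspondence $(\phi,X)$ over $A$ is a triple $(\alpha,B,\psi)$ of a $C^*$-algebra $B$, a nondegenerate injective $*$-homomorphism $\alpha\colon A\to B$ and a $*$-homomorphism $\psi\colon B\to\mathrm{End}_A(X)$ such that $\psi\circ\alpha=\phi$, $\alpha(J_\phi)\subseteq J_\psi$, and the induced map $A/J_\phi\to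 B/J_\psi$ is an isomorphism. The associated *in-split correspondence* over $B$ is the interior tensor product $X\otimes_\alpha B$ with left action $(\psi\otimes\mathrm{Id})(b')(x\otimes b)=\psi(b')x\otimes b$. **Proposition.** Let $E$ be a topological graph and let $I=(\alpha,E^0_I,\psi)$ be an in-split of $E$. Then there are $*$-homomorphisms $\alpha^*\colon C_0(E^0)\to C_0(E^0_I)$ and $\psi^*\colon C_0(E^0_I)\to \mathrm{End}_{C_0(E^0)}(X(E))$ satisfying $$\alpha^*(f)=f\circ\alpha\quad(f\in C_0(E^0)),\qquad (\psi^*(f)x)(e)=f(\psi(e))\,x(e)\quad (f\in C_0(E^0_I),\ x\in C_c(E^1),\ e\in E^1),$$ such that $(\alpha^*,C_0(E^0_I),\psi^*)$ is an in-split of the (nondegenerate) graph correspondence $(\phi,X(E))$. Moreover, the in-split correspondence $(\psi^*\otimes\mathrm{Id},\,X(E)\otimes_{\alpha^*}C_0(E^0_I))$ is isomorphic to $(\phi_I,X(E_I))$ as a correspondence over $C_0(E^0_I)$: there is a linear bijection $\beta\colon X(E)\otimes_{\alpha^*}C_0(E^0_I)\to X(E_I)$ which preserves the $C_0(E_I^0)$-valued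 inner products and intertwines the left and the right actions of $C_0(E^0_I)$. -/

import Mathlib

open scoped ZeroAtInfty CompactlySupported TensorProduct ComplexConjugate

/-- A right `A`-module `V` with an `A`-valued semi-inner product `(x ∣ y)_A`, which is conjugate
linear in `x`, linear in `y` and satisfies `(x ∣ y · a)_A = (x ∣ y)_A a`; `act x a` is `x · a`.
Positive elements of `A` are those of the form `a* a`. It is not required that `(x ∣ x)_A = 0`
implies `x = 0`. (Mathlib's `CStarModule` has `(x ∣ a • y) = a (x ∣ y)`, the convention for left
modules, and is always definite, so it does not cover right modules over noncommutative algebras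
or their pre-completions.) -/
structure PreHilbertModule (A V : Type*) [NonUnitalCStarAlgebra A] [AddCommGroup V]
    [Module ℂ V] where
  act : V →ₗ[ℂ] A →ₗ[ℂ] V
  act_mul : ∀ x a b, act x (a * b) = act (act x a) b
  ip : V →ₗ⋆[ℂ] V →ₗ[ℂ] A
  ip_act : ∀ x y a, ip x (act y a) = ip x y * a
  star_ip : ∀ x y, star (ip x y) = ip y x
  ip_self : ∀ x, ∃ a, ip x x = star a * a

namespace PreHilbertModule

variable {A V : Type*} [NonUnitalCStarAlgebra A] [AddCommGroup V] [Module ℂ V]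
  (P : PreHilbertModule A V)

theorem act_ip (x y : V) (a : A) : P.ip (P.act x a) y = star a * P.ip x y := by
  rw [← P.star_ip, P.ip_act, star_mul, P.star_ip]

theorem norm_ip_sq_le (x y : V) : ‖P.ip x y‖ ^ 2 ≤ ‖P.ip x x‖ * ‖P.ip y y‖ := by
  let _ := CStarAlgebra.spectralOrder A
  have := CStarAlgebra.spectralOrderedRing A
  have key : ∀ t : ℝ, ‖P.ip x x‖ < t → ‖P.ip x y‖ ^ 2 ≤ t * ‖P.ip y y‖ := by
    intro t ht
    have ht0 : 0 < t := (norm_nonneg _).trans_lt ht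
    set a := P.ip x y with ha
    have hpos : 0 ≤ P.ip (P.act x a - (t : ℂ) • y) (P.act x a - (t : ℂ) • y) := by
      obtain ⟨b, hb⟩ := P.ip_self (P.act x a - (t : ℂ) • y)
      rw [hb]; exact star_mul_self_nonneg b
    have hexp : P.ip (P.act x a - (t : ℂ) • y) (P.act x a - (t : ℂ) • y)
        = star a * P.ip x x * a - t • (star a * a) - t • (star a * a)
          + t • t • P.ip y y := by
      have h1 : P.ip y x = star a := by rw [ha, P.star_ip]
      simp only [map_sub, LinearMap.sub_apply, LinearMap.map_smulₛₗ, LinearMap.smul_apply,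
        P.act_ip, P.ip_act, ← ha, h1, map_smul, Complex.conj_ofReal, mul_assoc]
      simp only [Complex.coe_smul, smul_sub, sub_sub, sub_add]
      abel_nf
    have h1 : star a * P.ip x x * a ≤ t • (star a * a) := by
      refine (CStarAlgebra.star_left_conjugate_le_norm_smul (hb := P.star_ip x x)).trans ?_
      exact smul_le_smul_of_nonneg_right ht.le (star_mul_self_nonneg a)
    rw [hexp] at hpos
    have h2 : t • (star a * a) ≤ t • t • P.ip y y := by
      have := add_le_add hpos h1
      rw [zero_add] at this
      have h3 := sub_nonneg.2 this
      have h4 : (0 : A) ≤ t • t • P.ip y y - t • (star a * a) := by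
        have h5 := add_nonneg hpos (sub_nonneg.2 h1)
        convert h5 using 1
        abel
      exact sub_nonneg.1 h4
    have h3 : star a * a ≤ t • P.ip y y := (smul_le_smul_iff_of_pos_left ht0).1 h2
    have h4 := CStarAlgebra.norm_le_norm_of_nonneg_of_le (star_mul_self_nonneg a) h3
    rw [CStarRing.norm_star_mul_self, norm_smul, Real.norm_of_nonneg ht0.le] at h4
    nlinarith
  refine le_of_forall_pos_le_add fun ε hε => ?_
  have h := key (‖P.ip x x‖ + ε / (‖P.ip y y‖ + 1)) (by
    have : 0 < ε / (‖P.ip y y‖ + 1) := by positivity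
    linarith)
  refine h.trans ?_
  have h2 : ε / (‖P.ip y y‖ + 1) * ‖P.ip y y‖ ≤ ε := by
    rw [div_mul_eq_mul_div, div_le_iff₀ (by positivity)]
    nlinarith [norm_nonneg (P.ip y y)]
  nlinarith

theorem sqrt_norm_smul (c : ℂ) (x : V) :
    √‖P.ip (c • x) (c • x)‖ = ‖c‖ * √‖P.ip x x‖ := by
  rw [LinearMap.map_smulₛₗ₂, map_smul, norm_smul, norm_smul, ← mul_assoc,
    Real.sqrt_mul (by positivity), RCLike.norm_conj, Real.sqrt_mul_self (norm_nonneg _)]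

theorem norm_ip_le_sqrt (x y : V) : ‖P.ip x y‖ ≤ √‖P.ip x x‖ * √‖P.ip y y‖ := by
  rw [← Real.sqrt_mul (norm_nonneg _)]
  exact Real.le_sqrt_of_sq_le (P.norm_ip_sq_le x y)

theorem sqrt_norm_add (x y : V) :
    √‖P.ip (x + y) (x + y)‖ ≤ √‖P.ip x x‖ + √‖P.ip y y‖ := by
  refine Real.sqrt_le_iff.2 ⟨add_nonneg (Real.sqrt_nonneg _) (Real.sqrt_nonneg _), ?_⟩
  have h := P.norm_ip_le_sqrt x y
  have h' := P.norm_ip_le_sqrt y x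
  have hx := Real.sq_sqrt (norm_nonneg (P.ip x x))
  have hy := Real.sq_sqrt (norm_nonneg (P.ip y y))
  calc ‖P.ip (x + y) (x + y)‖
      = ‖P.ip x x + P.ip x y + (P.ip y x + P.ip y y)‖ := by
        simp only [map_add, LinearMap.add_apply]
        congr 1; abel
    _ ≤ (‖P.ip x x‖ + ‖P.ip x y‖) + (‖P.ip y x‖ + ‖P.ip y y‖) :=
        (norm_add_le _ _).trans (add_le_add (norm_add_le _ _) (norm_add_le _ _))
    _ ≤ (√‖P.ip x x‖ + √‖P.ip y y‖) ^ 2 := by nlinarith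

/-- The space `V`, seminormed by `‖x‖ = ‖(x ∣ x)‖^{1/2}`. -/
def Pre (_ : PreHilbertModule A V) : Type _ := V

instance : AddCommGroup P.Pre := inferInstanceAs (AddCommGroup V)
instance : Module ℂ P.Pre := inferInstanceAs (Module ℂ V)

/-- The identity map `V → P.Pre`. -/
def toPre : V ≃ₗ[ℂ] P.Pre := LinearEquiv.refl ℂ V

noncomputable instance : Norm P.Pre := ⟨fun x => √‖P.ip (P.toPre.symm x) (P.toPre.symm x)‖⟩

theorem seminormedCore : SeminormedSpace.Core ℂ P.Pre where
  norm_nonneg _ := Real.sqrt_nonneg _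
  norm_smul c x := P.sqrt_norm_smul c (P.toPre.symm x)
  norm_triangle x y := P.sqrt_norm_add (P.toPre.symm x) (P.toPre.symm y)

noncomputable instance : SeminormedAddCommGroup P.Pre := .ofCore P.seminormedCore
noncomputable instance : NormedSpace ℂ P.Pre where
  norm_smul_le c x := (P.seminormedCore.norm_smul c x).le

/-- The Hausdorff completion of `V` for the seminorm `‖x‖ = ‖(x ∣ x)‖^{1/2}`: null vectors are
identified with `0`. -/
def Completion : Type _ := UniformSpace.Completion P.Pre

noncomputable instance : NormedAddCommGroup P.Completion :=
  inferInstanceAs (NormedAddCommGroup (UniformSpace.Completion P.Pre))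
noncomputable instance : NormedSpace ℂ P.Completion :=
  inferInstanceAs (NormedSpace ℂ (UniformSpace.Completion P.Pre))
instance : CompleteSpace P.Completion :=
  inferInstanceAs (CompleteSpace (UniformSpace.Completion P.Pre))

/-- The canonical map of `V` into its completion. -/
noncomputable def ι : V →ₗ[ℂ] P.Completion :=
  (UniformSpace.Completion.toComplL (𝕜 := ℂ) (E := P.Pre)).toLinearMap ∘ₗ P.toPre.toLinearMap

theorem norm_ι (x : V) : ‖P.ι x‖ = √‖P.ip x x‖ :=
  UniformSpace.Completion.norm_coe (P.toPre x)

theorem norm_ι_sq (x : V) : ‖P.ι x‖ ^ 2 = ‖P.ip x x‖ := by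
  rw [norm_ι, Real.sq_sqrt (norm_nonneg _)]

theorem denseRange_ι : DenseRange P.ι :=
  UniformSpace.Completion.denseRange_coe (α := P.Pre)

theorem norm_ip_le (x y : V) : ‖P.ip x y‖ ≤ ‖P.ι x‖ * ‖P.ι y‖ := by
  rw [norm_ι, norm_ι]; exact P.norm_ip_le_sqrt x y

theorem norm_act_le (x : V) (a : A) : ‖P.ι (P.act x a)‖ ≤ ‖a‖ * ‖P.ι x‖ := by
  refine le_of_sq_le_sq ?_ (by positivity)
  rw [mul_pow, norm_ι_sq, norm_ι_sq, P.ip_act, P.act_ip]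
  calc ‖star a * P.ip x x * a‖ ≤ ‖star a‖ * ‖P.ip x x‖ * ‖a‖ :=
        (norm_mul_le _ _).trans (by gcongr; exact norm_mul_le _ _)
    _ = ‖a‖ ^ 2 * ‖P.ip x x‖ := by rw [norm_star]; ring

theorem induction_ι {p : P.Completion → Prop} (hp : IsClosed {x | p x}) (h : ∀ x, p (P.ι x))
    (x : P.Completion) : p x :=
  P.denseRange_ι.induction_on x hp h

/-- For fixed `x : V`, the extension of `y ↦ (x ∣ y)` to the completion. -/
noncomputable def ipRight (x : V) : P.Completion →L[ℂ] A := (P.ip x).extendOfNorm P.ι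

theorem ipRight_ι (x y : V) : P.ipRight x (P.ι y) = P.ip x y :=
  LinearMap.extendOfNorm_eq P.denseRange_ι ⟨_, P.norm_ip_le x⟩ y

/-- `ipRight` as a conjugate linear map. -/
noncomputable def ipRightₗ : V →ₗ⋆[ℂ] P.Completion →L[ℂ] A where
  toFun := P.ipRight
  map_add' x y := by
    ext z
    induction z using P.induction_ι with
    | hp => exact isClosed_eq (by fun_prop) (by fun_prop)
    | h z => simp [ipRight_ι]
  map_smul' c x := by
    ext z
    induction z using P.induction_ι with
    | hp => exact isClosed_eq (by fun_prop) (by fun_prop)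
    | h z => simp [ipRight_ι]

theorem norm_ipRightₗ_le (x : V) : ‖P.ipRightₗ x‖ ≤ 1 * ‖P.ι x‖ := by
  rw [one_mul]
  exact LinearMap.opNorm_extendOfNorm_le P.denseRange_ι (norm_nonneg _) (P.norm_ip_le x)

/-- The inner product of the completion. -/
noncomputable def ipCompletion : P.Completion →L⋆[ℂ] P.Completion →L[ℂ] A :=
  P.ipRightₗ.extendOfNorm P.ι

theorem ipCompletion_ι (x y : V) : P.ipCompletion (P.ι x) (P.ι y) = P.ip x y := by
  rw [ipCompletion, LinearMap.extendOfNorm_eq P.denseRange_ι ⟨_, P.norm_ipRightₗ_le⟩]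
  exact P.ipRight_ι x y

/-- Right multiplication by `a` on the completion. -/
noncomputable def actCompletion (a : A) : P.Completion →L[ℂ] P.Completion :=
  (P.ι ∘ₗ P.act.flip a).extendOfNorm P.ι

theorem actCompletion_ι (a : A) (x : V) : P.actCompletion a (P.ι x) = P.ι (P.act x a) :=
  LinearMap.extendOfNorm_eq P.denseRange_ι ⟨_, fun x => P.norm_act_le x a⟩ x

/-- The right action of `A` on the completion. -/
noncomputable def actCompletionₗ : P.Completion →ₗ[ℂ] A →ₗ[ℂ] P.Completion :=
  LinearMap.flip
    { toFun := fun a => (P.actCompletion a).toLinearMap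
      map_add' := fun a b => by
        ext x
        induction x using P.induction_ι with
        | hp =>
          exact isClosed_eq (P.actCompletion (a + b)).continuous
            ((P.actCompletion a).continuous.add (P.actCompletion b).continuous)
        | h x => simp [actCompletion_ι]
      map_smul' := fun c a => by
        ext x
        induction x using P.induction_ι with
        | hp =>
          exact isClosed_eq (P.actCompletion (c • a)).continuous
            ((P.actCompletion a).continuous.const_smul c)
        | h x => simp [actCompletion_ι] }

theorem actCompletionₗ_apply (x : P.Completion) (a : A) :
    P.actCompletionₗ x a = P.actCompletion a x := rfl

end PreHilbertModule

/-- A right Hilbert `A`-module: `X` is complete for the norm `‖x‖ = ‖(x ∣ x)_A‖^{1/2}` (so the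
inner product is definite). -/
class HilbertModule (A X : Type*) [NonUnitalCStarAlgebra A] [NormedAddCommGroup X]
    [NormedSpace ℂ X] where
  toPre : PreHilbertModule A X
  norm_sq : ∀ x, ‖x‖ ^ 2 = ‖toPre.ip x x‖
  complete : CompleteSpace X

namespace PreHilbertModule

variable {A V : Type*} [NonUnitalCStarAlgebra A] [AddCommGroup V] [Module ℂ V]
  (P : PreHilbertModule A V)

/-- The extension of the module structure and of the inner product to the completion. -/
noncomputable def completionPre : PreHilbertModule A P.Completion where
  act := P.actCompletionₗ
  act_mul x a b := by
    simp only [actCompletionₗ_apply]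
    induction x using P.induction_ι with
    | hp => exact isClosed_eq (by fun_prop) (by fun_prop)
    | h x => simp [actCompletion_ι, P.act_mul]
  ip := ContinuousLinearMap.coeLM ℂ ∘ₛₗ P.ipCompletion.toLinearMap
  ip_act x y a := by
    change P.ipCompletion x (P.actCompletion a y) = P.ipCompletion x y * a
    induction x using P.induction_ι with
    | hp => exact isClosed_eq (by fun_prop) (by fun_prop)
    | h x =>
      induction y using P.induction_ι with
      | hp => exact isClosed_eq (by fun_prop) (by fun_prop)
      | h y => simp [actCompletion_ι, ipCompletion_ι, P.ip_act]
  star_ip x y := by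
    change star (P.ipCompletion x y) = P.ipCompletion y x
    induction x using P.induction_ι with
    | hp => exact isClosed_eq (by fun_prop) (by fun_prop)
    | h x =>
      induction y using P.induction_ι with
      | hp => exact isClosed_eq (by fun_prop) (by fun_prop)
      | h y => simp [ipCompletion_ι, P.star_ip]
  ip_self x := by
    let _ := CStarAlgebra.spectralOrder A
    have := CStarAlgebra.spectralOrderedRing A
    change ∃ a, P.ipCompletion x x = star a * a
    rw [← CStarAlgebra.nonneg_iff_eq_star_mul_self]
    induction x using P.induction_ι with
    | hp => exact isClosed_le (by fun_prop) (by fun_prop)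
    | h x =>
      rw [ipCompletion_ι]
      obtain ⟨a, ha⟩ := P.ip_self x
      rw [ha]; exact star_mul_self_nonneg a

noncomputable instance instHilbertModule : HilbertModule A P.Completion where
  toPre := P.completionPre
  norm_sq x := by
    change ‖x‖ ^ 2 = ‖P.ipCompletion x x‖
    induction x using P.induction_ι with
    | hp => exact isClosed_eq (by fun_prop) (by fun_prop)
    | h x => rw [ipCompletion_ι, norm_ι_sq]
  complete := inferInstance

end PreHilbertModule

namespace HilbertModule

variable (A : Type*) {X : Type*} [NonUnitalCStarAlgebra A] [NormedAddCommGroup X]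
  [NormedSpace ℂ X] [HilbertModule A X]

/-- The inner product `(x ∣ y)_A` of a Hilbert module. -/
noncomputable abbrev ip (x y : X) : A := (toPre (A := A) (X := X)).ip x y

/-- The right action `x · a` on a Hilbert module. -/
noncomputable abbrev act {A : Type*} [NonUnitalCStarAlgebra A] [HilbertModule A X]
    (x : X) (a : A) : X :=
  (toPre (A := A) (X := X)).act x a

theorem ip_self_eq_zero {x : X} (h : ip A x x = 0) : x = 0 := by
  have : ‖x‖ ^ 2 = ‖ip A x x‖ := norm_sq (A := A) x
  rw [h, norm_zero] at this
  simpa using this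

theorem ext_ip {x y : X} (h : ∀ z, ip A z x = ip A z y) : x = y := by
  refine sub_eq_zero.1 (ip_self_eq_zero A ?_)
  rw [ip, map_sub, sub_eq_zero]
  exact h _

variable (X) in
/-- The `*`-algebra `End_A(X)` of adjointable operators, with the operator norm. (Adjointable maps
are automatically linear, `A`-linear and bounded.) The adjoint of `T` is `star T`. -/
def Adjointable : Subalgebra ℂ (X →L[ℂ] X) where
  carrier := {T | ∃ S : X →L[ℂ] X, ∀ x y, ip A (T x) y = ip A x (S y)}
  mul_mem' := by
    rintro T T' ⟨S, hS⟩ ⟨S', hS'⟩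
    exact ⟨S' * S, fun x y => by simp [hS, hS']⟩
  add_mem' := by
    rintro T T' ⟨S, hS⟩ ⟨S', hS'⟩
    refine ⟨S + S', fun x y => ?_⟩
    have h1 := hS x y
    have h2 := hS' x y
    simp only [ip] at h1 h2 ⊢
    simp [h1, h2]
  algebraMap_mem' c := by
    refine ⟨algebraMap ℂ _ (star c), fun x y => ?_⟩
    simp [Algebra.algebraMap_eq_smul_one, ip]

namespace Adjointable

variable {A}

/-- The adjoint, which is unique because the inner product is definite. -/
noncomputable instance : Star (Adjointable A X) where
  star T := ⟨T.2.choose, T.1, fun x y => by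
    have h := T.2.choose_spec y x
    have h2 := congrArg star h
    simp only [ip, PreHilbertModule.star_ip] at h2 ⊢
    exact h2.symm⟩

theorem ip_star (T : Adjointable A X) (x y : X) :
    ip A (T.1 x) y = ip A x ((star T).1 y) := T.2.choose_spec x y

theorem ext_adj {S T : Adjointable A X} (h : ∀ x y, ip A x (S.1 y) = ip A x (T.1 y)) : S = T :=
  Subtype.ext (ContinuousLinearMap.ext fun y => ext_ip A fun x => h x y)

theorem ip_star_left (T : Adjointable A X) (x y : X) :
    ip A ((star T).1 x) y = ip A x (T.1 y) := by
  have h := congrArg star (ip_star T y x)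
  simp only [ip, PreHilbertModule.star_ip] at h ⊢
  exact h.symm

noncomputable instance : StarRing (Adjointable A X) where
  star_involutive T := ext_adj fun x y => by rw [← ip_star, ip_star_left]
  star_mul S T := ext_adj fun x y => by
    rw [← ip_star]
    change ip A (S.1 (T.1 x)) y = ip A x ((star T).1 ((star S).1 y))
    rw [ip_star, ip_star]
  star_add S T := ext_adj fun x y => by
    rw [← ip_star]
    have h1 := ip_star S x y
    have h2 := ip_star T x y
    simp only [ip] at h1 h2 ⊢
    change PreHilbertModule.ip _ (S.1 x + T.1 x) y
      = PreHilbertModule.ip _ x ((star S).1 y + (star T).1 y)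
    simp [h1, h2]

/-- The generalised compact operators: the closed linear span of the rank-one operators
`z ↦ x · (y ∣ z)_A`. -/
noncomputable def compacts (A X : Type*) [NonUnitalCStarAlgebra A] [NormedAddCommGroup X]
    [NormedSpace ℂ X] [HilbertModule A X] : Submodule ℂ (Adjointable A X) :=
  (Submodule.span ℂ {T | ∃ x y : X, ∀ z, T.1 z = act x (ip A y z)}).topologicalClosure

end Adjointable

end HilbertModule

open HilbertModule

section Correspondences

variable {A B X Y : Type*} [NonUnitalCStarAlgebra A] [NonUnitalCStarAlgebra B]
  [NormedAddCommGroup X] [NormedSpace ℂ X] [HilbertModule A X]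
  [NormedAddCommGroup Y] [NormedSpace ℂ Y] [HilbertModule B Y]

/-- The left action `φ` is nondegenerate: `φ(B)X` spans a dense subspace of `X`. -/
def IsNondegenerateAction (φ : B →⋆ₙₐ[ℂ] Adjointable A X) : Prop :=
  (Submodule.span ℂ {y : X | ∃ b x, y = (φ b).1 x}).topologicalClosure = ⊤

/-- The `*`-homomorphism `α` is nondegenerate: `α(A)B` spans a dense subspace of `B`. -/
def IsNondegenerateHom (α : A →⋆ₙₐ[ℂ] B) : Prop :=
  (Submodule.span ℂ {y : B | ∃ a b, y = α a * b}).topologicalClosure = ⊤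

/-- The ideal `J_φ = φ⁻¹(End⁰_A(X)) ∩ ker(φ)^⊥` of a left action `φ`. -/
noncomputable def covarianceIdeal (φ : B →⋆ₙₐ[ℂ] Adjointable A X) : Submodule ℂ B where
  carrier := {b | φ b ∈ Adjointable.compacts A X ∧ ∀ c, φ c = 0 → b * c = 0}
  add_mem' := by
    rintro a b ⟨ha, ha'⟩ ⟨hb, hb'⟩
    refine ⟨by rw [map_add]; exact add_mem ha hb, fun c hc => ?_⟩
    rw [add_mul, ha' c hc, hb' c hc, add_zero]
  zero_mem' := ⟨by rw [map_zero]; exact zero_mem _, fun c _ => zero_mul c⟩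
  smul_mem' := by
    rintro t b ⟨hb, hb'⟩
    refine ⟨by rw [map_smul]; exact Submodule.smul_mem _ t hb, fun c hc => ?_⟩
    rw [smul_mul_assoc, hb' c hc, smul_zero]

/-- `(α, B, ψ)` is an in-split of the nondegenerate correspondence `(φ, X)` over `A`. Here an
`A`-correspondence is a Hilbert `A`-module `X` with a `*`-homomorphism `φ : A → End_A(X)`. -/
structure IsInSplit (φ : A →⋆ₙₐ[ℂ] Adjointable A X) (α : A →⋆ₙₐ[ℂ] B)
    (ψ : B →⋆ₙₐ[ℂ] Adjointable A X) : Prop where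
  nondegenerate : IsNondegenerateAction φ
  hom_nondegenerate : IsNondegenerateHom α
  hom_injective : Function.Injective α
  comp_eq : ψ.comp α = φ
  map_ideal : covarianceIdeal φ ≤ (covarianceIdeal ψ).comap (LinearMapClass.linearMap α)
  /-- The induced `*`-homomorphism `A/J_φ → B/J_ψ` is an isomorphism, i.e. bijective. -/
  quotient_bijective : Function.Bijective
    ((covarianceIdeal φ).mapQ (covarianceIdeal ψ) (LinearMapClass.linearMap α) map_ideal)

/-- The pair `(α, β)` is a morphism of correspondences `(φX, X) → (φY, Y)`. -/
structure IsCorrespondenceMorphism (φX : A →⋆ₙₐ[ℂ] Adjointable A X)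
    (φY : B →⋆ₙₐ[ℂ] Adjointable B Y) (α : A →⋆ₙₐ[ℂ] B) (β : X →ₗ[ℂ] Y) : Prop where
  map_ip : ∀ x y, ip B (β x) (β y) = α (ip A x y)
  map_act : ∀ x a, β (act x a) = act (β x) (α a)
  map_left : ∀ a x, β ((φX a).1 x) = (φY (α a)).1 (β x)

end Correspondences

/-- A left action of `C` by adjointable operators on a pre-Hilbert module. -/
structure PreHilbertModule.LeftAction {A V : Type*} (C : Type*) [NonUnitalCStarAlgebra A]
    [AddCommGroup V] [Module ℂ V] [NonUnitalCStarAlgebra C] (P : PreHilbertModule A V) where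
  toHom : C →ₙₐ[ℂ] Module.End ℂ V
  ip_left : ∀ c x y, P.ip (toHom c x) y = P.ip x (toHom (star c) y)

namespace PreHilbertModule.LeftAction

variable {A V C : Type*} [NonUnitalCStarAlgebra A]
    [AddCommGroup V] [Module ℂ V] [NonUnitalCStarAlgebra C] {P : PreHilbertModule A V}
    (π : P.LeftAction C)

theorem norm_le (c : C) (x : V) : ‖P.ι (π.toHom c x)‖ ≤ ‖c‖ * ‖P.ι x‖ := by
  let _ := CStarAlgebra.spectralOrder A
  have := CStarAlgebra.spectralOrderedRing A
  let _ := CStarAlgebra.spectralOrder (Unitization ℂ C)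
  have := CStarAlgebra.spectralOrderedRing (Unitization ℂ C)
  let σ : Unitization ℂ C →ₐ[ℂ] Module.End ℂ V := Unitization.lift π.toHom
  have hσ : ∀ d x y, P.ip (σ d x) y = P.ip x (σ (star d) y) := by
    intro d x y
    induction d using Unitization.ind with
    | inl_add_inr r e => simp [σ, π.ip_left, Algebra.algebraMap_eq_smul_one]
  have hle : star (c : Unitization ℂ C) * c ≤ algebraMap ℝ _ (‖(c : Unitization ℂ C)‖ ^ 2) :=
    CStarAlgebra.star_mul_le_algebraMap_norm_sq
  rw [← sub_nonneg, CStarAlgebra.nonneg_iff_eq_star_mul_self] at hle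
  obtain ⟨d, hd⟩ := hle
  have hc : σ (c : Unitization ℂ C) = π.toHom c := by simp [σ]
  have h1 : P.ip (π.toHom c x) (π.toHom c x) + P.ip (σ d x) (σ d x)
      = ((‖c‖ ^ 2 : ℝ) : ℂ) • P.ip x x := by
    rw [← hc, hσ, hσ, ← map_add, ← Module.End.mul_apply, ← Module.End.mul_apply,
      ← LinearMap.add_apply, ← map_mul, ← map_mul, ← map_add, ← hd, add_sub_cancel,
      Unitization.norm_inr, IsScalarTower.algebraMap_apply ℝ ℂ (Unitization ℂ C),
      AlgHom.commutes, Algebra.algebraMap_eq_smul_one]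
    simp
  have h2 : P.ip (π.toHom c x) (π.toHom c x) ≤ ((‖c‖ ^ 2 : ℝ) : ℂ) • P.ip x x := by
    rw [← h1, le_add_iff_nonneg_right]
    obtain ⟨a, ha⟩ := P.ip_self (σ d x)
    rw [ha]; exact star_mul_self_nonneg a
  have h0 : 0 ≤ P.ip (π.toHom c x) (π.toHom c x) := by
    obtain ⟨a, ha⟩ := P.ip_self (π.toHom c x)
    rw [ha]; exact star_mul_self_nonneg a
  have h3 := CStarAlgebra.norm_le_norm_of_nonneg_of_le h0 h2
  rw [norm_smul, ← norm_ι_sq, ← norm_ι_sq, Complex.norm_real,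
    Real.norm_of_nonneg (by positivity), ← mul_pow] at h3
  exact le_of_sq_le_sq h3 (by positivity)

/-- The operator of `c` on the completion. -/
noncomputable def extendCLM (c : C) : P.Completion →L[ℂ] P.Completion :=
  (P.ι ∘ₗ π.toHom c).extendOfNorm P.ι

theorem extendCLM_ι (c : C) (x : V) : π.extendCLM c (P.ι x) = P.ι (π.toHom c x) :=
  LinearMap.extendOfNorm_eq P.denseRange_ι ⟨_, π.norm_le c⟩ x

theorem ip_extendCLM (c : C) (x y : P.Completion) :
    HilbertModule.ip A (π.extendCLM c x) y = HilbertModule.ip A x (π.extendCLM (star c) y) := by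
  change P.ipCompletion (π.extendCLM c x) y = P.ipCompletion x (π.extendCLM (star c) y)
  induction x using P.induction_ι with
  | hp => exact isClosed_eq (by fun_prop) (by fun_prop)
  | h x =>
    induction y using P.induction_ι with
    | hp => exact isClosed_eq (by fun_prop) (by fun_prop)
    | h y => rw [extendCLM_ι, extendCLM_ι, ipCompletion_ι, ipCompletion_ι, π.ip_left]

/-- The extension of a left action to the completion, as a `*`-homomorphism
into the adjointable operators. -/
noncomputable def extend : C →⋆ₙₐ[ℂ] Adjointable A P.Completion where
  toFun c := ⟨π.extendCLM c, π.extendCLM (star c), π.ip_extendCLM c⟩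
  map_smul' t c := Subtype.ext <| ContinuousLinearMap.ext fun x => by
    induction x using P.induction_ι with
    | hp => exact isClosed_eq (by fun_prop) (by fun_prop)
    | h x => simp [extendCLM_ι]
  map_zero' := Subtype.ext <| ContinuousLinearMap.ext fun x => by
    induction x using P.induction_ι with
    | hp => exact isClosed_eq (by fun_prop) (by fun_prop)
    | h x => simp [extendCLM_ι]
  map_add' c d := Subtype.ext <| ContinuousLinearMap.ext fun x => by
    induction x using P.induction_ι with
    | hp => exact isClosed_eq (by fun_prop) (by fun_prop)
    | h x => simp [extendCLM_ι]
  map_mul' c d := Subtype.ext <| ContinuousLinearMap.ext fun x => by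
    induction x using P.induction_ι with
    | hp => exact isClosed_eq (by fun_prop) (by fun_prop)
    | h x => simp [extendCLM_ι]
  map_star' c := Adjointable.ext_adj fun x y => by
    rw [← Adjointable.ip_star]
    exact (π.ip_extendCLM c x y).symm

theorem extend_ι (c : C) (x : V) : (π.extend c).1 (P.ι x) = P.ι (π.toHom c x) :=
  π.extendCLM_ι c x

end PreHilbertModule.LeftAction

namespace HilbertModule

section Positivity

variable {A X : Type*} [NonUnitalCStarAlgebra A] [NormedAddCommGroup X]
  [NormedSpace ℂ X] [HilbertModule A X]

theorem exists_pos_sub_pos {D : Type*} [NonUnitalCStarAlgebra D] (T : D) (hT : IsSelfAdjoint T) :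
    ∃ p m : D, T = star p * p - star m * m ∧ star m * m * (star p * p) = 0 := by
  let _ := CStarAlgebra.spectralOrder D
  have := CStarAlgebra.spectralOrderedRing D
  obtain ⟨p, hp⟩ := CStarAlgebra.nonneg_iff_eq_star_mul_self.1 (CFC.posPart_nonneg T)
  obtain ⟨m, hm⟩ := CStarAlgebra.nonneg_iff_eq_star_mul_self.1 (CFC.negPart_nonneg T)
  refine ⟨p, m, ?_, ?_⟩
  · rw [← hp, ← hm, CFC.posPart_sub_negPart T hT]
  · rw [← hp, ← hm, CFC.negPart_mul_posPart]

/-- The Gram matrix of finitely many vectors is of the form `M* M`. -/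
theorem exists_gram_eq {n : Type*} [Fintype n] (x : n → X) :
    ∃ M : n → n → A, ∀ i j, ip A (x i) (x j) = ∑ k, star (M k i) * M k j := by
  classical
  let _ := CStarAlgebra.spectralOrder A
  have := CStarAlgebra.spectralOrderedRing A
  let T : CStarMatrix n n A := CStarMatrix.ofMatrix (Matrix.of fun i j => ip A (x i) (x j))
  have hT : IsSelfAdjoint T := by
    ext i j
    simp [T, CStarMatrix.star_apply, ip, PreHilbertModule.star_ip]
  obtain ⟨p, m, hTN, hmp⟩ := exists_pos_sub_pos T hT
  set N : CStarMatrix n n A := star m * m with hm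
  have hNs : star N = N := by rw [hm, star_mul, star_star]
  have h1 : N * T * N = - (star (m * N) * (m * N)) := by
    have : star (m * N) * (m * N) = N * N * N := by
      rw [star_mul, hNs]
      simp only [hm, mul_assoc]
    rw [this, hTN, mul_sub, hmp, zero_sub, neg_mul]
  have h2 : ∀ k, (N * T * N) k k
      = ip A (∑ i, act (x i) (N i k)) (∑ i, act (x i) (N i k)) := by
    intro k
    have hs : ∀ i, N k i = star (N i k) := fun i => by
      conv_lhs => rw [← hNs]
      rfl
    simp only [CStarMatrix.mul_apply, ip, act, map_sum, LinearMap.sum_apply,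
      PreHilbertModule.ip_act, PreHilbertModule.act_ip, Finset.sum_mul, hs]
    rfl
  have h3 : m * N = 0 := by
    ext i k
    have h4 : (N * T * N) k k = - ∑ i, star ((m * N) i k) * (m * N) i k := by
      rw [h1]
      simp [CStarMatrix.mul_apply, CStarMatrix.star_apply]
    have h5 : 0 ≤ (N * T * N) k k := by
      rw [h2]
      obtain ⟨a, ha⟩ := (toPre (A := A) (X := X)).ip_self (∑ i, act (x i) (N i k))
      rw [ip, ha]; exact star_mul_self_nonneg a
    rw [h4] at h5
    have h6 : ∀ i ∈ Finset.univ, 0 ≤ star ((m * N) i k) * (m * N) i k :=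
      fun i _ => star_mul_self_nonneg _
    have h7 := (Finset.sum_eq_zero_iff_of_nonneg h6).1
      (le_antisymm (neg_nonneg.1 h5) (Finset.sum_nonneg h6)) i (Finset.mem_univ i)
    simpa using h7
  have h8 : N = 0 := by
    have h9 : N * N = 0 := by rw [hm, mul_assoc, ← hm, h3, mul_zero]
    have : star N * N = 0 := by rw [hNs, h9]
    simpa using this
  have hT0 : T = star p * p := by rw [hTN, h8, sub_zero]
  refine ⟨fun i j => p i j, fun i j => ?_⟩
  have := congrFun (congrFun hT0 i) j
  simpa [T, CStarMatrix.mul_apply, CStarMatrix.star_apply] using this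

end Positivity

section Tensor

variable {A B : Type*} (X : Type*) [NonUnitalCStarAlgebra A] [NonUnitalCStarAlgebra B]
  [NormedAddCommGroup X] [NormedSpace ℂ X] [HilbertModule A X] (α : A →⋆ₙₐ[ℂ] B)

/-- The linear map `x' ⊗ b' ↦ b* α((x ∣ x')_A) b'`. -/
noncomputable def tensorIpRight (x : X) (b : B) : X ⊗[ℂ] B →ₗ[ℂ] B :=
  TensorProduct.lift <| LinearMap.mk₂ ℂ (fun x' b' => star b * α (ip A x x') * b')
    (fun x y c => by simp [ip, mul_add, add_mul])
    (fun t x c => by simp [ip, mul_smul_comm, smul_mul_assoc])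
    (fun x c d => by simp [mul_add])
    (fun t x c => by simp [mul_smul_comm])

/-- The sesquilinear form `(x ⊗ b ∣ x' ⊗ b') = b* α((x ∣ x')_A) b'`. -/
noncomputable def tensorIp : X ⊗[ℂ] B →ₗ⋆[ℂ] X ⊗[ℂ] B →ₗ[ℂ] B :=
  TensorProduct.lift <| LinearMap.mk₂'ₛₗ (starRingEnd ℂ) (starRingEnd ℂ) (tensorIpRight X α)
    (fun x y c => by ext; simp [tensorIpRight, ip, mul_add, add_mul])
    (fun t x c => by ext; simp [tensorIpRight, ip, mul_smul_comm, smul_mul_assoc])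
    (fun x c d => by ext; simp [tensorIpRight, add_mul])
    (fun t x c => by ext; simp [tensorIpRight, smul_mul_assoc])

theorem tensorIp_tmul (x x' : X) (b b' : B) :
    tensorIp X α (x ⊗ₜ b) (x' ⊗ₜ b') = star b * α (ip A x x') * b' := by
  simp [tensorIp, tensorIpRight]

/-- The algebraic tensor product `X ⊗ B` with `(x ⊗ b) · c = x ⊗ bc` and
`(x ⊗ b ∣ x' ⊗ b') = b* α((x ∣ x')_A) b'`. -/
noncomputable def tensorPre : PreHilbertModule B (X ⊗[ℂ] B) where
  act := ((LinearMap.lTensorHom X).comp (LinearMap.mul ℂ B).flip).flip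
  act_mul z a b := by
    induction z with
    | zero => simp
    | tmul x c => simp [mul_assoc]
    | add z w hz hw => simp only [map_add, LinearMap.add_apply, hz, hw]
  ip := tensorIp X α
  ip_act z w a := by
    induction z with
    | zero => simp
    | tmul x c =>
      induction w with
      | zero => simp
      | tmul y d => simp [tensorIp_tmul, mul_assoc]
      | add z w hz hw => simp only [map_add, LinearMap.add_apply, hz, hw, add_mul]
    | add z w hz hw => simp only [map_add, LinearMap.add_apply, hz, hw, add_mul]
  star_ip z w := by
    induction z with
    | zero => simp
    | tmul x c =>
      induction w with
      | zero => simp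
      | tmul y d => simp [tensorIp_tmul, mul_assoc, ← map_star, ip, PreHilbertModule.star_ip]
      | add z w hz hw => simp only [map_add, LinearMap.add_apply, star_add, hz, hw]
    | add z w hz hw => simp only [map_add, LinearMap.add_apply, star_add, hz, hw]
  ip_self z := by
    let _ := CStarAlgebra.spectralOrder B
    have := CStarAlgebra.spectralOrderedRing B
    obtain ⟨S, rfl⟩ := TensorProduct.exists_finset z
    obtain ⟨M, hM⟩ := exists_gram_eq (A := A) (fun i : S => i.1.1)
    rw [← CStarAlgebra.nonneg_iff_eq_star_mul_self, ← Finset.sum_coe_sort]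
    have : tensorIp X α (∑ i : S, i.1.1 ⊗ₜ[ℂ] i.1.2) (∑ i : S, i.1.1 ⊗ₜ[ℂ] i.1.2)
        = ∑ k : S, star (∑ i : S, α (M k i) * i.1.2) * (∑ i : S, α (M k i) * i.1.2) := by
      simp only [map_sum, LinearMap.sum_apply, tensorIp_tmul, hM, star_sum, star_mul,
        Finset.sum_mul, Finset.mul_sum, map_mul, map_star, mul_assoc]
      exact (Finset.sum_congr rfl fun j _ => Finset.sum_comm).trans Finset.sum_comm
    rw [this]
    exact Finset.sum_nonneg fun k _ => star_mul_self_nonneg _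

/-- The interior tensor product `X ⊗_α B`, a Hilbert `B`-module. -/
abbrev Tensor : Type _ := (tensorPre X α).Completion

/-- The elementary tensor `x ⊗ b` in `X ⊗_α B`. -/
noncomputable def tmul {X : Type*} [NormedAddCommGroup X] [NormedSpace ℂ X] [HilbertModule A X]
    (α : A →⋆ₙₐ[ℂ] B) (x : X) (b : B) : Tensor X α := (tensorPre X α).ι (x ⊗ₜ b)

variable {C : Type*} [NonUnitalCStarAlgebra C] {X}

/-- The left action `c (x ⊗ b) = ψ(c) x ⊗ b` on the algebraic tensor product. -/
noncomputable def tensorLeftAction (ψ : C →⋆ₙₐ[ℂ] Adjointable A X) :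
    (tensorPre X α).LeftAction C where
  toHom :=
    { toFun := fun c => LinearMap.rTensor B (ψ c).1.toLinearMap
      map_smul' := fun t c => by ext; simp [TensorProduct.smul_tmul']
      map_zero' := by ext; simp
      map_add' := fun c d => by ext; simp
      map_mul' := fun c d => by ext; simp }
  ip_left c z w := by
    change tensorIp X α _ _ = tensorIp X α _ _
    induction z with
    | zero => simp
    | tmul x b =>
      induction w with
      | zero => simp
      | tmul y d => simp [tensorIp_tmul, Adjointable.ip_star, map_star]
      | add z w hz hw => simp only [map_add, hz, hw]
    | add z w hz hw => simp only [map_add, LinearMap.add_apply, hz, hw]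

/-- The left action `ψ ⊗ Id` on `X ⊗_α B`. -/
noncomputable def tensorAction (ψ : C →⋆ₙₐ[ℂ] Adjointable A X) :
    C →⋆ₙₐ[ℂ] Adjointable B (Tensor X α) :=
  (tensorLeftAction α ψ).extend

theorem tensorAction_tmul (ψ : C →⋆ₙₐ[ℂ] Adjointable A X) (c : C) (x : X) (b : B) :
    (tensorAction α ψ c).1 (tmul α x b) = tmul α ((ψ c).1 x) b :=
  (tensorLeftAction α ψ).extend_ι c (x ⊗ₜ b)

end Tensor

end HilbertModule

section SingularSets

variable {X Y : Type*} [TopologicalSpace X] [TopologicalSpace Y]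

/-- The `ψ`-sources `Y ∖ closure ψ(X)`. -/
def sourceSet (ψ : X → Y) : Set Y := (closure (Set.range ψ))ᶜ

/-- The `ψ`-finite receivers: points with a precompact open neighbourhood `U` such that
`ψ⁻¹(closure U)` is compact. -/
def finiteReceiverSet (ψ : X → Y) : Set Y :=
  {y | ∃ U : Set Y, IsOpen U ∧ y ∈ U ∧ IsCompact (closure U) ∧ IsCompact (ψ ⁻¹' closure U)}

/-- The `ψ`-regular points. -/
def regularSet (ψ : X → Y) : Set Y := finiteReceiverSet ψ \ closure (sourceSet ψ)

/-- The `ψ`-singular points. -/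
def singularSet (ψ : X → Y) : Set Y := (regularSet ψ)ᶜ

end SingularSets

section FiberSum

open Topology Filter

variable {V E : Type*} [TopologicalSpace V] [TopologicalSpace E] {s : E → V}

theorem IsLocalHomeomorph.finite_fiber_inter (hs : IsLocalHomeomorph s) {K : Set E}
    (hK : IsCompact K) (v : V) : (s ⁻¹' {v} ∩ K).Finite := by
  have h : ∀ e : E, ∃ U ∈ 𝓝 e, Set.InjOn s U := fun e => by
    obtain ⟨U, hU, he, hi⟩ := hs.isLocallyInjective e
    exact ⟨U, hU.mem_nhds he, hi⟩
  choose U hU hinj using h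
  obtain ⟨t, -, ht⟩ := hK.elim_nhds_subcover U fun e _ => hU e
  refine Set.Finite.subset (t.finite_toSet.biUnion (t := fun e => s ⁻¹' {v} ∩ U e) fun e _ => ?_) ?_
  · refine Set.Subsingleton.finite fun a ha b hb => hinj e ha.2 hb.2 ?_
    rw [ha.1, hb.1]
  · rintro e ⟨he, heK⟩
    obtain ⟨i, hi, hie⟩ := Set.mem_iUnion₂.1 (ht heK)
    exact Set.mem_iUnion₂.2 ⟨i, hi, he, hie⟩

theorem continuous_fiberSum_of_injOn [T2Space V] (hs : IsLocalHomeomorph s) {f : E → ℂ}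
    (hf : Continuous f) (hc : HasCompactSupport f) {U : Set E} (hU : IsOpen U)
    (hi : Set.InjOn s U) (hfU : tsupport f ⊆ U) :
    Continuous fun v => ∑ᶠ e ∈ s ⁻¹' {v}, f e := by
  have hF : ∀ e ∈ U, ∑ᶠ e' ∈ s ⁻¹' {s e}, f e' = f e := by
    intro e he
    rw [← finsum_mem_singleton (f := f) (a := e)]
    refine finsum_mem_inter_support_eq _ _ _ (Set.ext fun e' => ?_)
    simp only [Set.mem_inter_iff, Set.mem_preimage, Set.mem_singleton_iff]
    refine and_congr_left fun h => ⟨fun h' => hi (hfU (subset_tsupport f h)) he h', ?_⟩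
    rintro rfl; rfl
  rw [continuous_iff_continuousAt]
  intro v
  by_cases hv : v ∈ s '' tsupport f
  · obtain ⟨e, he, rfl⟩ := hv
    rw [ContinuousAt, hF e (hfU he), ← hs.map_nhds_eq e, tendsto_map'_iff]
    refine (hf.tendsto e).congr' ?_
    filter_upwards [hU.mem_nhds (hfU he)] with e' he'
    exact (hF e' he').symm
  · have hcl : IsClosed (s '' tsupport f) := (hc.image hs.continuous).isClosed
    have h0 : ∀ w ∉ s '' tsupport f, ∑ᶠ e ∈ s ⁻¹' {w}, f e = 0 := by
      intro w hw
      refine finsum_mem_eq_zero_of_forall_eq_zero fun e he => ?_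
      by_contra hne
      exact hw ⟨e, subset_tsupport f hne, he⟩
    rw [ContinuousAt, h0 v hv]
    refine tendsto_const_nhds.congr' ?_
    filter_upwards [hcl.isOpen_compl.mem_nhds hv] with w hw
    exact (h0 w hw).symm

theorem continuous_fiberSum [T2Space V] [T2Space E] [LocallyCompactSpace E]
    (hs : IsLocalHomeomorph s) {f : E → ℂ} (hf : Continuous f) (hc : HasCompactSupport f) :
    Continuous fun v => ∑ᶠ e ∈ s ⁻¹' {v}, f e := by
  have h : ∀ e : E, ∃ U : Set E, IsOpen U ∧ e ∈ U ∧ Set.InjOn s U := hs.isLocallyInjective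
  choose U hU heU hinj using h
  obtain ⟨t, -, ht⟩ := hc.isCompact.elim_nhds_subcover U fun e _ => (hU e).mem_nhds (heU e)
  let g : Fin t.card → Set E := fun i => U (t.equivFin.symm i)
  have hcov : tsupport f ⊆ ⋃ i, g i := by
    intro e he
    obtain ⟨i, hi, hie⟩ := Set.mem_iUnion₂.1 (ht he)
    exact Set.mem_iUnion.2 ⟨t.equivFin ⟨i, hi⟩, by simpa [g] using hie⟩
  obtain ⟨ρ, hρs, hρ1, -, hρc⟩ :=
    exists_continuous_sum_one_of_isOpen_isCompact (fun i => hU _) hc.isCompact hcov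
  have hsum : ∀ e, f e = ∑ i, (ρ i e : ℂ) * f e := by
    intro e
    rw [← Finset.sum_mul]
    by_cases he : f e = 0
    · simp [he]
    · have h1 := hρ1 (subset_tsupport f he)
      simp only [Finset.sum_apply, Pi.one_apply] at h1
      rw [← Complex.ofReal_sum, h1, Complex.ofReal_one, one_mul]
  have hcont : ∀ i, Continuous fun v => ∑ᶠ e ∈ s ⁻¹' {v}, (ρ i e : ℂ) * f e := by
    intro i
    refine continuous_fiberSum_of_injOn hs (by fun_prop) hc.mul_left (hU _)
      (hinj (t.equivFin.symm i)) ((closure_mono ?_).trans (hρs i))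
    intro e he
    have := left_ne_zero_of_mul he
    simpa using this
  refine (continuous_finsetSum Finset.univ fun i _ => hcont i).congr fun v => ?_
  have hfin := hs.finite_fiber_inter hc.isCompact v
  have key : ∀ k : E → ℂ, (Function.support k ⊆ tsupport f) →
      ∑ᶠ e ∈ s ⁻¹' {v}, k e = ∑ e ∈ hfin.toFinset, k e := by
    intro k hk
    refine finsum_mem_eq_sum_of_inter_support_eq _ (Set.ext fun e => ?_)
    simp only [Set.Finite.coe_toFinset, Set.mem_inter_iff]
    exact ⟨fun h => ⟨⟨h.1, hk h.2⟩, h.2⟩, fun h => ⟨h.1.1, h.2⟩⟩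
  rw [key f (subset_tsupport f)]
  rw [Finset.sum_congr rfl fun i _ => key (fun e => (ρ i e : ℂ) * f e) fun e he =>
    subset_tsupport f (right_ne_zero_of_mul he), Finset.sum_comm]
  exact Finset.sum_congr rfl fun e _ => (hsum e).symm

end FiberSum

/-- A topological graph with vertex space `V` and edge space `E`: a continuous range map `r` and a
local homeomorphism `s`, the source map. The assumptions that `V` and `E` are second countable
locally compact Hausdorff spaces are made by type classes where they are used. -/
structure TopologicalGraph (V E : Type*) [TopologicalSpace V] [TopologicalSpace E] where
  r : C(E, V)
  s : E → V
  isLocalHomeomorph_s : IsLocalHomeomorph s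

namespace TopologicalGraph

/-- The function `e ↦ g(ψ(e)) x(e)`. -/
noncomputable def mulComp {E W : Type*} [TopologicalSpace E] [TopologicalSpace W]
    (ψ : C(E, W)) (g : C₀(W, ℂ)) (x : C_c(E, ℂ)) : C_c(E, ℂ) where
  toFun e := g (ψ e) * x e
  continuous_toFun := by fun_prop
  hasCompactSupport' := x.hasCompactSupport.mul_left

theorem mulComp_apply {E W : Type*} [TopologicalSpace E] [TopologicalSpace W]
    (ψ : C(E, W)) (g : C₀(W, ℂ)) (x : C_c(E, ℂ)) (e : E) :
    mulComp ψ g x e = g (ψ e) * x e := rfl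

theorem exists_finset {V E : Type*} [TopologicalSpace V] [TopologicalSpace E]
    (G : TopologicalGraph V E) {K : Set E} (hK : IsCompact K) (v : V) :
    ∃ t : Finset E, (∀ e ∈ t, G.s e = v) ∧ ∀ e, G.s e = v → e ∈ K → e ∈ t := by
  have := G.isLocalHomeomorph_s.finite_fiber_inter hK v
  exact ⟨this.toFinset, fun e he => ((this.mem_toFinset).1 he).1,
    fun e h1 h2 => this.mem_toFinset.2 ⟨h1, h2⟩⟩

section Correspondence

variable {V E W : Type*} [TopologicalSpace V] [TopologicalSpace E] [TopologicalSpace W]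
  [T2Space V] [T2Space E] [LocallyCompactSpace E] (G : TopologicalGraph V E)

/-- The function `v ↦ ∑_{s(e) = v} f(e)`, a finite sum for every `v`. -/
noncomputable def fiberSum (f : C_c(E, ℂ)) : C₀(V, ℂ) where
  toFun v := ∑ᶠ e ∈ G.s ⁻¹' {v}, f e
  continuous_toFun :=
    continuous_fiberSum G.isLocalHomeomorph_s f.continuous f.hasCompactSupport
  zero_at_infty' := by
    refine HasCompactSupport.is_zero_at_infty (HasCompactSupport.intro
      (f.hasCompactSupport.image G.isLocalHomeomorph_s.continuous) fun v hv => ?_)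
    refine finsum_mem_eq_zero_of_forall_eq_zero fun e he => ?_
    by_contra hne
    exact hv ⟨e, subset_tsupport f hne, he⟩

theorem fiberSum_apply (f : C_c(E, ℂ)) (v : V) :
    G.fiberSum f v = ∑ᶠ e ∈ G.s ⁻¹' {v}, f e := rfl

theorem fiberSum_eq_sum (f : C_c(E, ℂ)) (v : V) {t : Finset E} (ht : ∀ e ∈ t, G.s e = v)
    (h : ∀ e, G.s e = v → f e ≠ 0 → e ∈ t) : G.fiberSum f v = ∑ e ∈ t, f e := by
  refine finsum_mem_eq_sum_of_inter_support_eq _ (Set.ext fun e => ?_)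
  simp only [Set.mem_inter_iff, Function.mem_support, SetLike.mem_coe]
  exact ⟨fun h' => ⟨h e h'.1 h'.2, h'.2⟩, fun h' => ⟨ht e h'.1, h'.2⟩⟩

/-- For `x ∈ C_c(E)`, all inner products with `x` are sums over one finite set. -/
theorem exists_finset_fiberSum (x : C_c(E, ℂ)) (v : V) :
    ∃ t : Finset E, (∀ e ∈ t, G.s e = v) ∧ ∀ f : C_c(E, ℂ), (∀ e, x e = 0 → f e = 0) →
      G.fiberSum f v = ∑ e ∈ t, f e := by
  obtain ⟨t, ht, ht'⟩ := G.exists_finset x.hasCompactSupport.isCompact v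
  refine ⟨t, ht, fun f hf => G.fiberSum_eq_sum f v ht fun e he hne => ht' e he ?_⟩
  exact subset_tsupport x fun h => hne (hf e h)

theorem fiberSum_star_mul_self (x : C_c(E, ℂ)) (v : V) :
    ∃ r : ℝ, 0 ≤ r ∧ G.fiberSum (star x * x) v = r := by
  obtain ⟨t, -, ht⟩ := G.exists_finset_fiberSum x v
  refine ⟨∑ e ∈ t, Complex.normSq (x e), Finset.sum_nonneg fun e _ => Complex.normSq_nonneg _, ?_⟩
  rw [ht _ fun e he => by simp [he], Complex.ofReal_sum]
  exact Finset.sum_congr rfl fun e _ => by simp [Complex.normSq_eq_conj_mul_self]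

/-- `C_c(E)` with `(x · a)(e) = x(e) a(s(e))` and `(x ∣ y)(v) = ∑_{s(e) = v} conj(x(e)) y(e)`. -/
noncomputable def preModule : PreHilbertModule C₀(V, ℂ) C_c(E, ℂ) where
  act := LinearMap.mk₂ ℂ (fun x a => mulComp ⟨G.s, G.isLocalHomeomorph_s.continuous⟩ a x)
    (fun x y a => by ext e; simp [mulComp_apply, mul_add])
    (fun t x a => by ext e; simp [mulComp_apply, mul_left_comm])
    (fun x a b => by ext e; simp [mulComp_apply, add_mul])
    (fun t x a => by ext e; simp [mulComp_apply, mul_assoc])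
  act_mul x a b := by ext e; simp [mulComp_apply, mul_assoc, mul_left_comm]
  ip := LinearMap.mk₂'ₛₗ (starRingEnd ℂ) (RingHom.id ℂ) (fun x y => G.fiberSum (star x * y))
    (fun x y z => by
      ext v
      obtain ⟨t, -, ht⟩ := G.exists_finset_fiberSum z v
      rw [ZeroAtInftyContinuousMap.add_apply, ht _ fun e he => by simp [he],
        ht _ fun e he => by simp [he], ht _ fun e he => by simp [he]]
      simp [add_mul, Finset.sum_add_distrib])
    (fun c x z => by
      ext v
      obtain ⟨t, -, ht⟩ := G.exists_finset_fiberSum z v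
      rw [ZeroAtInftyContinuousMap.smul_apply, ht _ fun e he => by simp [he],
        ht _ fun e he => by simp [he]]
      simp [mul_assoc, Finset.mul_sum])
    (fun z x y => by
      ext v
      obtain ⟨t, -, ht⟩ := G.exists_finset_fiberSum z v
      rw [ZeroAtInftyContinuousMap.add_apply, ht _ fun e he => by simp [he],
        ht _ fun e he => by simp [he], ht _ fun e he => by simp [he]]
      simp [mul_add, Finset.sum_add_distrib])
    (fun c z x => by
      ext v
      obtain ⟨t, -, ht⟩ := G.exists_finset_fiberSum z v
      rw [ZeroAtInftyContinuousMap.smul_apply, ht _ fun e he => by simp [he],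
        ht _ fun e he => by simp [he]]
      simp [mul_left_comm, Finset.mul_sum])
  ip_act x y a := by
    ext v
    obtain ⟨t, hv, ht⟩ := G.exists_finset_fiberSum x v
    simp only [LinearMap.mk₂'ₛₗ_apply, LinearMap.mk₂_apply]
    rw [ZeroAtInftyContinuousMap.mul_apply, ht _ fun e he => by simp [he],
      ht _ fun e he => by simp [he], Finset.sum_mul]
    refine Finset.sum_congr rfl fun e he => ?_
    simp only [CompactlySupportedContinuousMap.mul_apply, mulComp_apply, ContinuousMap.coe_mk,
      hv e he]
    ring
  star_ip x y := by
    ext v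
    obtain ⟨t, hv, ht⟩ := G.exists_finset_fiberSum x v
    simp only [LinearMap.mk₂'ₛₗ_apply, ZeroAtInftyContinuousMap.star_apply]
    rw [ht _ fun e he => by simp [he], ht _ fun e he => by simp [he], star_sum]
    refine Finset.sum_congr rfl fun e he => ?_
    simp [mul_comm]
  ip_self x := by
    refine ⟨⟨⟨fun v => ((√(G.fiberSum (star x * x) v).re : ℝ) : ℂ), by fun_prop⟩, ?_⟩, ?_⟩
    · have h1 : Continuous fun z : ℂ => ((√z.re : ℝ) : ℂ) := by fun_prop
      have h2 := (h1.tendsto 0).comp (G.fiberSum (star x * x)).zero_at_infty'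
      simp only [Complex.zero_re, Real.sqrt_zero, Complex.ofReal_zero] at h2
      exact h2
    · ext v
      obtain ⟨r, hr, h⟩ := G.fiberSum_star_mul_self x v
      simp only [LinearMap.mk₂'ₛₗ_apply, ZeroAtInftyContinuousMap.mul_apply,
        ZeroAtInftyContinuousMap.star_apply, ZeroAtInftyContinuousMap.coe_mk]
      rw [h, Complex.ofReal_re, Complex.star_def, Complex.conj_ofReal, ← Complex.ofReal_mul,
        Real.mul_self_sqrt hr]

/-- The Hilbert `C₀(V)`-module `X(G)`, the completion of `C_c(E)`. -/
abbrev X : Type _ := G.preModule.Completion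

/-- The canonical map `C_c(E) → X(G)`. -/
noncomputable def toX : C_c(E, ℂ) →ₗ[ℂ] G.X := G.preModule.ι

/-- Multiplication by `g ∘ ψ` on `C_c(E)`, as a left action of `C₀(W)`. -/
noncomputable def preAction (ψ : C(E, W)) : G.preModule.LeftAction C₀(W, ℂ) where
  toHom :=
    { toFun := fun g =>
        { toFun := mulComp ψ g
          map_add' := fun x y => by ext e; simp [mulComp_apply, mul_add]
          map_smul' := fun t x => by ext e; simp [mulComp_apply, mul_left_comm] }
      map_smul' := fun t g => by ext x e; simp [mulComp_apply, mul_assoc]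
      map_zero' := by ext x e; simp [mulComp_apply]
      map_add' := fun g h => by ext x e; simp [mulComp_apply, add_mul]
      map_mul' := fun g h => by ext x e; simp [mulComp_apply, mul_assoc] }
  ip_left g x y := by
    ext v
    obtain ⟨t, hv, ht⟩ := G.exists_finset_fiberSum x v
    change G.fiberSum (star (mulComp ψ g x) * y) v = G.fiberSum (star x * mulComp ψ (star g) y) v
    rw [ht _ fun e he => by simp [he, mulComp_apply], ht _ fun e he => by simp [he]]
    refine Finset.sum_congr rfl fun e he => ?_
    simp [mulComp_apply]
    ring

/-- The left action of the graph correspondence `X(G)`: `(a · x)(e) = a(r(e)) x(e)` on `C_c(E)`. -/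
noncomputable def leftAction : C₀(V, ℂ) →⋆ₙₐ[ℂ] Adjointable C₀(V, ℂ) G.X :=
  (G.preAction G.r).extend

end Correspondence

/-- An in-split `(α, W, ψ)` of a topological graph, where `W` is a locally compact Hausdorff space
(by type classes, where it is used). -/
structure InSplit {V E : Type*} [TopologicalSpace V] [TopologicalSpace E]
    (G : TopologicalGraph V E) (W : Type*) [TopologicalSpace W] where
  α : C(W, V)
  ψ : C(E, W)
  isProperMap_α : IsProperMap α
  surjective_α : Function.Surjective α
  /-- `α` restricts to a homeomorphism from the `ψ`-singular points of `W` onto the singular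
  points of `V`. -/
  singular_homeomorph : ∃ h : singularSet ψ ≃ₜ singularSet G.r, ∀ w, (h w : V) = α w
  α_ψ : ∀ e, α (ψ e) = G.r e

namespace InSplit

variable {V E W : Type*} [TopologicalSpace V] [TopologicalSpace E] [TopologicalSpace W]
  {G : TopologicalGraph V E} (I : G.InSplit W)

/-- The edge space `E ×_{s,α} W` of the in-split graph. -/
def Edge : Type _ := {p : E × W // G.s p.1 = I.α p.2}

instance : TopologicalSpace I.Edge := inferInstanceAs (TopologicalSpace (Subtype fun p : E × W => G.s p.1 = I.α p.2))

instance [T2Space E] [T2Space W] : T2Space I.Edge := inferInstanceAs (T2Space (Subtype fun p : E × W => G.s p.1 = I.α p.2))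

instance [T2Space V] [LocallyCompactSpace E] [LocallyCompactSpace W] :
    LocallyCompactSpace I.Edge :=
  (isClosed_eq (G.isLocalHomeomorph_s.continuous.comp continuous_fst)
    (I.α.continuous.comp continuous_snd)).isClosedEmbedding_subtypeVal.locallyCompactSpace

theorem isLocalHomeomorph_snd : IsLocalHomeomorph fun p : I.Edge => p.1.2 := by
  have hcont : Continuous fun p : I.Edge => p.1.2 := continuous_snd.comp continuous_subtype_val
  have hfst : Continuous fun p : I.Edge => p.1.1 := continuous_fst.comp continuous_subtype_val
  have hopen : IsOpenMap fun p : I.Edge => p.1.2 := by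
    rw [isOpenMap_iff_nhds_le]
    intro p S hS
    rw [Filter.mem_map] at hS
    obtain ⟨T, hT, hTS⟩ := mem_nhds_subtype _ _ _ |>.1 hS
    obtain ⟨A, hA, B, hB, hAB⟩ := mem_nhds_prod_iff.1 hT
    have h1 : G.s '' A ∈ nhds (I.α p.1.2) := by
      rw [← p.2]
      exact G.isLocalHomeomorph_s.isOpenMap.image_mem_nhds hA
    filter_upwards [hB, I.α.continuous.continuousAt.preimage_mem_nhds h1] with w hw hw'
    obtain ⟨e, he, hew⟩ := hw'
    exact hTS (show (⟨(e, w), hew⟩ : I.Edge) ∈ Subtype.val ⁻¹' T from hAB ⟨he, hw⟩)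
  rw [isLocalHomeomorph_iff_isOpenEmbedding_restrict]
  intro p
  obtain ⟨U, hU, heU, hi⟩ := G.isLocalHomeomorph_s.isLocallyInjective p.1.1
  have hN : IsOpen {q : I.Edge | q.1.1 ∈ U} := hU.preimage hfst
  refine ⟨_, hN.mem_nhds heU, .of_continuous_injective_isOpenMap
    (hcont.comp continuous_subtype_val) ?_ (hopen.domRestrict hN)⟩
  rintro ⟨q, hq⟩ ⟨q', hq'⟩ h
  have h : q.1.2 = q'.1.2 := h
  refine Subtype.ext (Subtype.ext (Prod.ext (hi hq hq' ?_) h))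
  rw [q.2, q'.2, h]

/-- The in-split graph: `r(e, w) = ψ(e)` and `s(e, w) = w`. -/
def graph : TopologicalGraph W I.Edge where
  r := ⟨fun p => I.ψ p.1.1, I.ψ.continuous.comp (continuous_fst.comp continuous_subtype_val)⟩
  s p := p.1.2
  isLocalHomeomorph_s := I.isLocalHomeomorph_snd

end InSplit

end TopologicalGraph

/-! The proof rests on computing the covariance ideals. For continuous `ψ : E → W`, let `C₀(W)` act
on `X(G)` by multiplication with `g ∘ ψ`. Then `J_ψ` is exactly the ideal of functions vanishing on
the `ψ`-singular set (`mem_covarianceIdeal_actionOf`). Orthogonality to the kernel, which consists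
of the `c` with `c ∘ ψ = 0`, means vanishing on the sources. Compactness is compared with decay of
`g ∘ ψ` at infinity on `E`. A compact operator is a norm limit of finite sums of rank-one operators,
so it is uniformly small off a compact set of edges; testing on bumps of norm at most 1 gives the
decay. Conversely, if `g ∘ ψ` has compact support, a partition of unity subordinate to open sets on
which `s` is injective writes the action of `g` as a finite sum of rank-one operators.

Applied to `r` and to `ψ`, this identifies the two quotients with functions on the closed singular
sets. The induced map between them is composition with `α` on these sets. It is injective because
`α` maps singular points onto singular points, and surjective by transport along the inverse
homeomorphism followed by Tietze extension (`isInSplit`).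

The isomorphism of correspondences sends `x ⊗ b` to `(e, w) ↦ x(e) b(w)`. The fibre of `s_I` over
`w` is a copy of the fibre of `s` over `α(w)`, so inner products agree (`fiberSum_edgeProd`). The
map is therefore isometric with closed range, and the range is dense because every element of
`C_c(E_I)` is a finite sum of such products (`exists_eq_sum_edgeProd`). -/

section FunctionSpaces

/-! ### Functions vanishing at infinity: truncation, cut-offs, extension. -/

variable {Y : Type*} [TopologicalSpace Y]

theorem ZeroAtInftyContinuousMap.norm_apply_le (f : C₀(Y, ℂ)) (y : Y) : ‖f y‖ ≤ ‖f‖ :=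
  f.toBCF.norm_coe_le_norm y

theorem ZeroAtInftyContinuousMap.norm_le_of_forall {f : C₀(Y, ℂ)} {C : ℝ} (hC : 0 ≤ C)
    (h : ∀ y, ‖f y‖ ≤ C) : ‖f‖ ≤ C :=
  (BoundedContinuousFunction.norm_le (f := f.toBCF) hC).2 h

theorem ZeroAtInftyContinuousMap.isCompact_le_norm (f : C₀(Y, ℂ)) {ε : ℝ} (hε : 0 < ε) :
    IsCompact {y | ε ≤ ‖f y‖} := by
  have h : ∀ᶠ y in Filter.cocompact Y, ‖f y‖ < ε :=
    f.zero_at_infty'.norm.eventually_lt_const (by simpa using hε)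
  obtain ⟨K, hK, hKf⟩ := Filter.mem_cocompact.1 h
  refine hK.of_isClosed_subset (isClosed_le (by fun_prop) (by fun_prop)) fun y hy => ?_
  by_contra hyK
  exact (not_lt.2 hy : ¬ ‖f y‖ < ε) (hKf hyK)

/-- The inclusion `C_c(Y) → C₀(Y)`. -/
def CompactlySupportedContinuousMap.toZeroAtInfty : C_c(Y, ℂ) →ₗ[ℂ] C₀(Y, ℂ) where
  toFun f := ⟨f.1, f.hasCompactSupport.is_zero_at_infty⟩
  map_add' _ _ := rfl
  map_smul' _ _ := rfl

@[simp]
theorem CompactlySupportedContinuousMap.toZeroAtInfty_apply (f : C_c(Y, ℂ)) (y : Y) :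
    f.toZeroAtInfty y = f y := rfl

/-- The soft threshold of `f` at level `ε`: it is within `ε` of `f`, and vanishes where
`‖f‖ ≤ ε`. -/
noncomputable def ZeroAtInftyContinuousMap.softThreshold (f : C₀(Y, ℂ)) {ε : ℝ} (hε : 0 < ε) :
    C₀(Y, ℂ) where
  toFun y := f y * ((1 - ε / max ‖f y‖ ε : ℝ) : ℂ)
  continuous_toFun := by
    -- Taking the maximum with `ε` keeps the denominator away from zero, so the factor is continuous
    -- even at zeros of `f`.
    have : ∀ y, max ‖f y‖ ε ≠ 0 := fun y => (hε.trans_le (le_max_right _ _)).ne'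
    fun_prop (disch := assumption)
  zero_at_infty' := by
    refine squeeze_zero_norm (fun y => ?_) (by simpa using f.zero_at_infty'.norm)
    have h0 : 0 < max ‖f y‖ ε := hε.trans_le (le_max_right _ _)
    have h1 : ε / max ‖f y‖ ε ≤ 1 := (div_le_one h0).2 (le_max_right _ _)
    have h2 : 0 ≤ ε / max ‖f y‖ ε := by positivity
    rw [norm_mul, Complex.norm_real, Real.norm_of_nonneg (by linarith)]
    exact mul_le_of_le_one_right (norm_nonneg _) (by linarith)

namespace ZeroAtInftyContinuousMap

variable (f : C₀(Y, ℂ)) {ε : ℝ} (hε : 0 < ε)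

theorem softThreshold_apply (y : Y) :
    f.softThreshold hε y = f y * ((1 - ε / max ‖f y‖ ε : ℝ) : ℂ) := rfl

theorem softThreshold_eq_zero {y : Y} (h : ‖f y‖ ≤ ε) : f.softThreshold hε y = 0 := by
  simp [softThreshold_apply, max_eq_right h, hε.ne']

theorem norm_sub_softThreshold_le : ‖f - f.softThreshold hε‖ ≤ ε := by
  refine norm_le_of_forall hε.le fun y => ?_
  have h0 : 0 < max ‖f y‖ ε := hε.trans_le (le_max_right _ _)
  have h1 : f y - f.softThreshold hε y = f y * ((ε / max ‖f y‖ ε : ℝ) : ℂ) := by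
    rw [softThreshold_apply]; push_cast; ring
  rw [sub_apply, h1, norm_mul, Complex.norm_real, Real.norm_of_nonneg (by positivity),
    mul_div_assoc', div_le_iff₀ h0, mul_comm]
  exact mul_le_mul_of_nonneg_left (le_max_left _ _) hε.le

/-- Although `ψ` need not be proper, only the preimage of one superlevel set matters. The case `ψ =
id` gives density of `C_c` in `C₀`; the general case produces compact operators. -/
theorem hasCompactSupport_softThreshold_comp {Z : Type*} [TopologicalSpace Z] {ψ : Z → Y}
    (hψ : Continuous ψ) (h : IsCompact (ψ ⁻¹' {y | ε ≤ ‖f y‖})) :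
    HasCompactSupport (f.softThreshold hε ∘ ψ) := by
  have hcl : IsClosed (ψ ⁻¹' {y | ε ≤ ‖f y‖}) :=
    (isClosed_le continuous_const (map_continuous f).norm).preimage hψ
  refine HasCompactSupport.intro' h hcl fun z hz => ?_
  exact f.softThreshold_eq_zero hε (not_le.1 hz).le

end ZeroAtInftyContinuousMap

theorem CompactlySupportedContinuousMap.denseRange_toZeroAtInfty :
    DenseRange (toZeroAtInfty : C_c(Y, ℂ) →ₗ[ℂ] C₀(Y, ℂ)) := by
  refine Metric.denseRange_iff.2 fun f ε hε => ?_
  have hε2 : 0 < ε / 2 := by linarith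
  refine ⟨⟨⟨f.softThreshold hε2, map_continuous _⟩,
    f.hasCompactSupport_softThreshold_comp hε2 continuous_id (f.isCompact_le_norm hε2)⟩, ?_⟩
  rw [dist_eq_norm]
  exact (f.norm_sub_softThreshold_le hε2).trans_lt (by linarith)

theorem CompactlySupportedContinuousMap.exists_eq_one [T2Space Y] [LocallyCompactSpace Y]
    {K U : Set Y} (hK : IsCompact K) (hU : IsOpen U) (hKU : K ⊆ U) :
    ∃ f : C_c(Y, ℂ), (∀ y ∈ K, f y = 1) ∧ (∀ y, f y ≠ 0 → y ∈ U) ∧ ∀ y, ‖f y‖ ≤ 1 := by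
  obtain ⟨f, h1, hc, hfU, h01⟩ :=
    exists_continuousMap_one_of_isCompact_subset_isOpen hK hU hKU
  refine ⟨⟨⟨fun y => (f y : ℂ), by fun_prop⟩,
      HasCompactSupport.comp_left (g := Complex.ofReal) hc rfl⟩,
    fun y hy => ?_, fun y hy => hfU (subset_tsupport _ ?_), fun y => ?_⟩
  · simpa using h1 hy
  · simpa using hy
  · have := h01 y
    simpa [abs_of_nonneg this.1] using this.2

/-- Tietze extension for `C₀`. -/
theorem ZeroAtInftyContinuousMap.exists_extension {F : Type*} [TopologicalSpace F] [T2Space Y]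
    [LocallyCompactSpace Y] {e : F → Y} (he : Topology.IsClosedEmbedding e) (f : C₀(F, ℂ)) :
    ∃ g : C₀(Y, ℂ), ∀ x, g (e x) = f x := by
  have : T2Space F := he.isEmbedding.t2Space
  -- A closed embedding is proper, so it extends to the one-point compactifications. There it is an
  -- injection of a compact space into a Hausdorff one, hence a closed embedding into a normal
  -- space, where the usual Tietze theorem applies.
  have hm : Continuous (OnePoint.map e) := OnePoint.continuous_map he.continuous <| by
    simpa [Filter.coclosedCompact_eq_cocompact] using he.tendsto_cocompact
  have hi : Function.Injective (OnePoint.map e) := Option.map_injective he.injective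
  obtain ⟨g, hg⟩ := ContinuousMap.exists_extension' (hm.isClosedEmbedding hi)
    (OnePoint.continuousMapMk f.1 0 (by
      rw [Filter.coclosedCompact_eq_cocompact]; exact f.zero_at_infty'))
  refine ⟨⟨⟨fun y => g y, g.continuous.comp OnePoint.continuous_coe⟩, ?_⟩,
    fun x => congrFun hg x⟩
  -- The extension agrees with the given function at infinity, where the latter is 0; continuity at
  -- that point is then vanishing at infinity.
  have h0 : g (OnePoint.infty) = 0 := congrFun hg OnePoint.infty
  have h1 := (OnePoint.continuous_iff g).1 g.continuous
  rw [h0, Filter.coclosedCompact_eq_cocompact] at h1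
  exact h1.1

end FunctionSpaces

/-! ### Singular sets, local decompositions and rank-one operators. -/

/-- A neighbourhood witnessing that one point is a finite receiver witnesses it for all its points,
so the finite receivers form an open set. -/
theorem isClosed_singularSet {X Y : Type*} [TopologicalSpace Y] [TopologicalSpace X] (ψ : X → Y) :
    IsClosed (singularSet ψ) := by
  have h : IsOpen (finiteReceiverSet ψ) := by
    refine isOpen_iff_forall_mem_open.2 ?_
    rintro y ⟨U, hU, hy, h1, h2⟩
    exact ⟨U, fun z hz => ⟨U, hU, hz, h1, h2⟩, hU, hy⟩
  exact (h.sdiff isClosed_closure).isClosed_compl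

/-- `h` is a finite sum of functions `u i`, with cut-offs `ξ i` which are `1` on the support of `u i`
and have support in an open set on which `s` is injective. -/
theorem IsLocalHomeomorph.exists_decomposition {V E : Type*} [TopologicalSpace V]
    [TopologicalSpace E] [T2Space E] [LocallyCompactSpace E] {s : E → V}
    (hs : IsLocalHomeomorph s) (h : C_c(E, ℂ)) :
    ∃ (n : ℕ) (u ξ : Fin n → C_c(E, ℂ)), h = ∑ i, u i ∧ (∀ i, u i * ξ i = u i) ∧
      ∀ i e e', ξ i e ≠ 0 → ξ i e' ≠ 0 → s e = s e' → e = e' := by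
  choose U hU heU hinj using fun e : E => hs.isLocallyInjective e
  obtain ⟨t, -, ht⟩ := h.hasCompactSupport.isCompact.elim_nhds_subcover U
    fun e _ => (hU e).mem_nhds (heU e)
  let g : Fin t.card → Set E := fun i => U (t.equivFin.symm i)
  have hcov : tsupport h ⊆ ⋃ i, g i := by
    intro e he
    obtain ⟨i, hi, hie⟩ := Set.mem_iUnion₂.1 (ht he)
    exact Set.mem_iUnion.2 ⟨t.equivFin ⟨i, hi⟩, by simpa [g] using hie⟩
  obtain ⟨ρ, hρs, hρ1, -, hρc⟩ :=
    exists_continuous_sum_one_of_isOpen_isCompact (fun i => hU _) h.hasCompactSupport.isCompact hcov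
  -- Each cut-off equals 1 on the support of a member of the partition of unity and lives in the
  -- same injectivity set.
  choose ξ hξ1 hξU _ using fun i => CompactlySupportedContinuousMap.exists_eq_one
    (hρc i).isCompact (hU (t.equivFin.symm i)) (hρs i)
  refine ⟨t.card, fun i => ⟨⟨fun e => (ρ i e : ℂ) * h e, by fun_prop⟩,
    h.hasCompactSupport.mul_left⟩, ξ, ?_, fun i => ?_, fun i e e' he he' hee => ?_⟩
  · ext e
    rw [CompactlySupportedContinuousMap.sum_apply]
    change h e = ∑ i, (ρ i e : ℂ) * h e
    rw [← Finset.sum_mul]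
    by_cases he : h e = 0
    · simp [he]
    · have h1 := hρ1 (subset_tsupport h he)
      simp only [Finset.sum_apply, Pi.one_apply] at h1
      rw [← Complex.ofReal_sum, h1, Complex.ofReal_one, one_mul]
  · ext e
    change ((ρ i e : ℂ) * h e) * ξ i e = (ρ i e : ℂ) * h e
    by_cases he : ρ i e = 0
    · simp [he]
    · rw [hξ1 i e (subset_tsupport _ he), mul_one]
  · exact hinj _ (hξU i e he) (hξU i e' he') hee

theorem HilbertModule.norm_act_le {A X : Type*} [NonUnitalCStarAlgebra A] [NormedAddCommGroup X]
    [NormedSpace ℂ X] [HilbertModule A X] (x : X) (a : A) : ‖act x a‖ ≤ ‖x‖ * ‖a‖ := by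
  refine le_of_sq_le_sq ?_ (by positivity)
  have h := norm_sq (A := A) x
  rw [norm_sq (A := A), PreHilbertModule.ip_act, PreHilbertModule.act_ip, mul_pow, h]
  calc ‖star a * toPre.ip x x * a‖ ≤ ‖star a‖ * ‖toPre.ip x x‖ * ‖a‖ :=
        (norm_mul_le _ _).trans (by gcongr; exact norm_mul_le _ _)
    _ = ‖toPre.ip x x‖ * ‖a‖ ^ 2 := by rw [norm_star]; ring

theorem HilbertModule.norm_ip_le {A X : Type*} [NonUnitalCStarAlgebra A] [NormedAddCommGroup X]
    [NormedSpace ℂ X] [HilbertModule A X] (x y : X) : ‖ip A x y‖ ≤ ‖x‖ * ‖y‖ := by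
  refine le_of_sq_le_sq ?_ (by positivity)
  rw [mul_pow, norm_sq (A := A) x, norm_sq (A := A) y]
  exact PreHilbertModule.norm_ip_sq_le _ x y

/-- Finitely many witnessing neighbourhoods cover `K`, and the preimages of their closures are
compact: `ψ` is proper over its finite receivers. -/
theorem isCompact_preimage_of_subset_finiteReceiverSet {X Y : Type*} [TopologicalSpace X]
    [TopologicalSpace Y] [T2Space Y] {ψ : X → Y} (hψ : Continuous ψ) {K : Set Y} (hK : IsCompact K)
    (h : K ⊆ finiteReceiverSet ψ) : IsCompact (ψ ⁻¹' K) := by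
  choose! U hU hyU _ hc using h
  obtain ⟨t, htK, ht⟩ := hK.elim_nhds_subcover U fun y hy => (hU hy).mem_nhds (hyU hy)
  refine (t.isCompact_biUnion fun y hy => hc (htK y hy)).of_isClosed_subset
    (hK.isClosed.preimage hψ) fun x hx => ?_
  obtain ⟨y, hy, hxy⟩ := Set.mem_iUnion₂.1 (ht hx)
  exact Set.mem_iUnion₂.2 ⟨y, hy, subset_closure hxy⟩

/-- The rank-one operator `z ↦ x · (y ∣ z)`. -/
noncomputable def HilbertModule.rankOne {A X : Type*} [NonUnitalCStarAlgebra A]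
    [NormedAddCommGroup X] [NormedSpace ℂ X] [HilbertModule A X] (x y : X) : Adjointable A X :=
  -- Quantified over all vectors because the adjoint is the rank-one operator with `x` and `y`
  -- exchanged and needs the same bound.
  have hb : ∀ x y z : X, ‖(toPre.act x ∘ₗ toPre.ip (A := A) y) z‖ ≤ ‖x‖ * ‖y‖ * ‖z‖ := by
    intro x y z
    refine (norm_act_le x (ip A y z)).trans ?_
    rw [mul_assoc]
    gcongr
    exact norm_ip_le y z
  ⟨(toPre.act x ∘ₗ toPre.ip (A := A) y).mkContinuous _ (hb x y),
    (toPre.act y ∘ₗ toPre.ip (A := A) x).mkContinuous _ (hb y x), fun z w => by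
      change toPre.ip (toPre.act x (toPre.ip y z)) w = toPre.ip z (toPre.act y (toPre.ip x w))
      rw [PreHilbertModule.act_ip, PreHilbertModule.ip_act, PreHilbertModule.star_ip]⟩

theorem HilbertModule.rankOne_apply {A X : Type*} [NonUnitalCStarAlgebra A]
    [NormedAddCommGroup X] [NormedSpace ℂ X] [HilbertModule A X] (x y z : X) :
    (rankOne (A := A) x y).1 z = act x (ip A y z) := rfl

/-! ### Compact operators on `X(G)` and the covariance ideal. -/

namespace TopologicalGraph

section Correspondence

variable {V E W : Type*} [TopologicalSpace V] [TopologicalSpace E] [TopologicalSpace W]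
  [T2Space V] [T2Space E] [LocallyCompactSpace E] (G : TopologicalGraph V E)

theorem preModule_act_apply (x : C_c(E, ℂ)) (a : C₀(V, ℂ)) (e : E) :
    G.preModule.act x a e = a (G.s e) * x e := rfl

theorem norm_toX_sq (x : C_c(E, ℂ)) : ‖G.toX x‖ ^ 2 = ‖G.fiberSum (star x * x)‖ :=
  G.preModule.norm_ι_sq x

theorem act_toX (x : C_c(E, ℂ)) (a : C₀(V, ℂ)) :
    act (G.toX x) a = G.toX (G.preModule.act x a) := G.preModule.actCompletion_ι a x

theorem ip_toX (x y : C_c(E, ℂ)) :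
    ip C₀(V, ℂ) (G.toX x) (G.toX y) = G.fiberSum (star x * y) := G.preModule.ipCompletion_ι x y

/-- If `s` is injective where `ξ` does not vanish, a fiber sum has at most one term. -/
theorem fiberSum_apply_source_of_injOn {ξ : E → ℂ}
    (hξ : ∀ e e', ξ e ≠ 0 → ξ e' ≠ 0 → G.s e = G.s e' → e = e') (f : C_c(E, ℂ))
    (hf : ∀ e, ξ e = 0 → f e = 0) {e : E} (he : ξ e ≠ 0) : G.fiberSum f (G.s e) = f e := by
  rw [G.fiberSum_eq_sum f _ (t := {e}) (by simp), Finset.sum_singleton]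
  intro e' hs hne
  rw [Finset.mem_singleton]
  exact hξ _ _ (fun h => hne (hf _ h)) he hs

theorem fiberSum_apply_eq_zero (f : C_c(E, ℂ)) {v : V} (h : ∀ e, G.s e = v → f e = 0) :
    G.fiberSum f v = 0 := finsum_mem_eq_zero_of_forall_eq_zero fun e he => h e he

/-- `‖x e‖ ^ 2` is one term of the nonnegative sum `(x ∣ x)(s(e))`. This domination of the sup norm
lets elements of the completion be evaluated at edges. -/
theorem norm_apply_le_norm_toX (x : C_c(E, ℂ)) (e : E) : ‖x e‖ ≤ ‖G.toX x‖ := by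
  refine le_of_sq_le_sq ?_ (norm_nonneg _)
  rw [norm_toX_sq]
  refine le_trans ?_ (ZeroAtInftyContinuousMap.norm_apply_le _ (G.s e))
  by_cases hx : x e = 0
  · simp [hx]
  obtain ⟨t, ht, ht'⟩ := G.exists_finset x.hasCompactSupport.isCompact (G.s e)
  rw [G.fiberSum_eq_sum _ _ ht fun e' hs hne => ht' e' hs
    (subset_tsupport x fun h => hne (by simp [h]))]
  have h1 : ∑ e' ∈ t, (star x * x) e' = ((∑ e' ∈ t, ‖x e'‖ ^ 2 : ℝ) : ℂ) := by
    push_cast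
    refine Finset.sum_congr rfl fun e' _ => ?_
    simpa using Complex.conj_mul' (x e')
  rw [h1, Complex.norm_real, Real.norm_of_nonneg (by positivity)]
  exact Finset.single_le_sum (f := fun e' => ‖x e'‖ ^ 2) (fun _ _ => by positivity)
    (ht' e rfl (subset_tsupport x hx))

/-- Each fibre meets the set where `x` is nonzero at most once, so the module norm is controlled by
the sup norm. It bounds the bump functions used to test operators. -/
theorem norm_toX_le_of_injOn {x : C_c(E, ℂ)}
    (hx : ∀ e e', x e ≠ 0 → x e' ≠ 0 → G.s e = G.s e' → e = e') (h1 : ∀ e, ‖x e‖ ≤ 1) :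
    ‖G.toX x‖ ≤ 1 := by
  refine le_of_sq_le_sq ?_ zero_le_one
  rw [norm_toX_sq, one_pow]
  refine ZeroAtInftyContinuousMap.norm_le_of_forall zero_le_one fun v => ?_
  by_cases hv : ∃ e, G.s e = v ∧ x e ≠ 0
  · obtain ⟨e, rfl, he⟩ := hv
    rw [G.fiberSum_apply_source_of_injOn hx _ (fun e he => by simp [he]) he]
    simpa using mul_le_one₀ (h1 e) (norm_nonneg _) (h1 e)
  · push Not at hv
    rw [G.fiberSum_apply_eq_zero _ fun e he => by simp [hv e he]]
    simp

/-- Elements of `X(G)` as functions on the edge space. -/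
noncomputable def toFunction : G.X →L[ℂ] C₀(E, ℂ) :=
  CompactlySupportedContinuousMap.toZeroAtInfty.extendOfNorm G.toX

theorem norm_toZeroAtInfty_le (x : C_c(E, ℂ)) : ‖x.toZeroAtInfty‖ ≤ 1 * ‖G.toX x‖ := by
  rw [one_mul]
  exact ZeroAtInftyContinuousMap.norm_le_of_forall (norm_nonneg _) (G.norm_apply_le_norm_toX x)

theorem toFunction_toX (x : C_c(E, ℂ)) : G.toFunction (G.toX x) = x.toZeroAtInfty :=
  LinearMap.extendOfNorm_eq G.preModule.denseRange_ι ⟨1, G.norm_toZeroAtInfty_le⟩ x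

theorem norm_toFunction_apply_le (x : G.X) (e : E) : ‖G.toFunction x e‖ ≤ ‖x‖ := by
  have h := LinearMap.norm_extendOfNorm_apply_le G.preModule.denseRange_ι 1
    G.norm_toZeroAtInfty_le x
  rw [one_mul] at h
  exact (ZeroAtInftyContinuousMap.norm_apply_le _ e).trans h

theorem continuous_toFunction_apply (e : E) : Continuous fun x : G.X => G.toFunction x e := by
  have h : Continuous fun g : C₀(E, ℂ) => g e := by
    refine LipschitzWith.continuous (K := 1) (LipschitzWith.mk_one fun f g => ?_)
    rw [dist_eq_norm, dist_eq_norm]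
    exact ZeroAtInftyContinuousMap.norm_apply_le (f - g) e
  exact h.comp G.toFunction.continuous

theorem induction_toX {p : G.X → Prop} (hp : IsClosed {x | p x}) (h : ∀ x, p (G.toX x))
    (x : G.X) : p x := G.preModule.induction_ι hp h x

theorem toFunction_act (x : G.X) (a : C₀(V, ℂ)) (e : E) :
    G.toFunction (act x a) e = a (G.s e) * G.toFunction x e := by
  induction x using G.induction_toX with
  | hp =>
    exact isClosed_eq ((G.continuous_toFunction_apply e).comp
      (G.preModule.actCompletion a).continuous)
      (continuous_const.mul (G.continuous_toFunction_apply e))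
  | h x => rw [act_toX, toFunction_toX, toFunction_toX]; rfl

/-- Compact operators on `X(G)` are uniformly small off a compact set of edges. -/
theorem exists_compact_of_mem_compacts {T : Adjointable C₀(V, ℂ) G.X}
    (hT : T ∈ Adjointable.compacts C₀(V, ℂ) G.X) {ε : ℝ} (hε : 0 < ε) :
    ∃ K : Set E, IsCompact K ∧ ∀ e ∉ K, ∀ z : G.X, ‖G.toFunction (T.1 z) e‖ ≤ ε * ‖z‖ := by
  -- The claim is first proved on the span, for every `δ` at once: sums and scalar multiples require
  -- a smaller bound on the pieces.
  have key : ∀ S ∈ Submodule.span ℂ {T : Adjointable C₀(V, ℂ) G.X |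
      ∃ x y : G.X, ∀ z, T.1 z = act x (ip C₀(V, ℂ) y z)}, ∀ δ : ℝ, 0 < δ →
      ∃ K : Set E, IsCompact K ∧ ∀ e ∉ K, ∀ z : G.X, ‖G.toFunction (S.1 z) e‖ ≤ δ * ‖z‖ := by
    intro S hS
    induction hS using Submodule.span_induction with
    | mem S hS =>
      obtain ⟨x, y, hxy⟩ := hS
      intro δ hδ
      -- For a rank-one operator the value at `e` is at most `‖x(e)‖ ‖y‖ ‖z‖`; the `+ 1` covers `y =
      -- 0`.
      have hδ' : 0 < δ / (‖y‖ + 1) := by positivity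
      refine ⟨_, (G.toFunction x).isCompact_le_norm hδ', fun e he z => ?_⟩
      have he : ‖G.toFunction x e‖ ≤ δ / (‖y‖ + 1) := (not_le.1 he).le
      rw [hxy, toFunction_act, norm_mul]
      calc _ ≤ (‖y‖ * ‖z‖) * (δ / (‖y‖ + 1)) := by
            gcongr
            exact (ZeroAtInftyContinuousMap.norm_apply_le _ _).trans (norm_ip_le y z)
        _ = δ * ‖z‖ * (‖y‖ / (‖y‖ + 1)) := by ring
        _ ≤ δ * ‖z‖ := mul_le_of_le_one_right (by positivity)
            ((div_le_one (by positivity)).2 (by linarith))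
    | zero =>
      intro δ hδ
      refine ⟨∅, isCompact_empty, fun e _ z => ?_⟩
      simpa using by positivity
    | add S S' _ _ h h' =>
      intro δ hδ
      obtain ⟨K, hK, hS⟩ := h (δ / 2) (by positivity)
      obtain ⟨K', hK', hS'⟩ := h' (δ / 2) (by positivity)
      refine ⟨K ∪ K', hK.union hK', fun e he z => ?_⟩
      rw [Set.mem_union, not_or] at he
      change ‖G.toFunction (S.1 z + S'.1 z) e‖ ≤ _
      rw [map_add, ZeroAtInftyContinuousMap.add_apply]
      linarith [norm_add_le (G.toFunction (S.1 z) e) (G.toFunction (S'.1 z) e),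
        hS e he.1 z, hS' e he.2 z]
    | smul c S _ h =>
      intro δ hδ
      obtain ⟨K, hK, hS⟩ := h (δ / (‖c‖ + 1)) (by positivity)
      refine ⟨K, hK, fun e he z => ?_⟩
      change ‖G.toFunction (c • S.1 z) e‖ ≤ _
      rw [map_smul, ZeroAtInftyContinuousMap.smul_apply, norm_smul]
      calc _ ≤ ‖c‖ * (δ / (‖c‖ + 1) * ‖z‖) := by gcongr; exact hS e he z
        _ = δ * ‖z‖ * (‖c‖ / (‖c‖ + 1)) := by ring
        _ ≤ δ * ‖z‖ := mul_le_of_le_one_right (by positivity)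
            ((div_le_one (by positivity)).2 (by linarith))
  obtain ⟨S, hS, hTS⟩ := Metric.mem_closure_iff.1 hT (ε / 2) (by positivity)
  obtain ⟨K, hK, hSK⟩ := key S hS (ε / 2) (by positivity)
  refine ⟨K, hK, fun e he z => ?_⟩
  have h1 : ‖(T.1 - S.1) z‖ ≤ ε / 2 * ‖z‖ := by
    refine (ContinuousLinearMap.le_opNorm _ _).trans ?_
    gcongr
    rw [← dist_eq_norm]
    exact hTS.le
  have h2 : T.1 z = (T.1 - S.1) z + S.1 z := by simp
  rw [h2, map_add, ZeroAtInftyContinuousMap.add_apply]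
  linarith [norm_add_le (G.toFunction ((T.1 - S.1) z) e) (G.toFunction (S.1 z) e),
    G.norm_toFunction_apply_le ((T.1 - S.1) z) e, hSK e he z]

/-- Multiplication by `g ∘ ψ`, as a left action of `C₀(W)` on `X(G)`. -/
noncomputable def actionOf (ψ : C(E, W)) : C₀(W, ℂ) →⋆ₙₐ[ℂ] Adjointable C₀(V, ℂ) G.X :=
  (G.preAction ψ).extend

theorem actionOf_toX (ψ : C(E, W)) (g : C₀(W, ℂ)) (x : C_c(E, ℂ)) :
    (G.actionOf ψ g).1 (G.toX x) = G.toX (mulComp ψ g x) := (G.preAction ψ).extend_ι g x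

theorem norm_actionOf_le (ψ : C(E, W)) (g : C₀(W, ℂ)) : ‖G.actionOf ψ g‖ ≤ ‖g‖ := by
  refine ContinuousLinearMap.opNorm_le_bound _ (norm_nonneg _) fun x => ?_
  induction x using G.induction_toX with
  | hp =>
    exact isClosed_le (G.actionOf ψ g).1.continuous.norm (continuous_const.mul continuous_norm)
  | h x =>
    change ‖(G.actionOf ψ g).1 (G.toX x)‖ ≤ _
    rw [actionOf_toX]
    exact (G.preAction ψ).norm_le g x

/-- Evaluating at `e` the action on a bump equal to 1 at `e` recovers `g (ψ e)`; this computes the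
kernel that enters the covariance ideal. -/
theorem actionOf_eq_zero_iff (ψ : C(E, W)) (g : C₀(W, ℂ)) :
    G.actionOf ψ g = 0 ↔ ∀ e, g (ψ e) = 0 := by
  constructor
  · intro h e
    obtain ⟨x, hx, -⟩ := CompactlySupportedContinuousMap.exists_eq_one (isCompact_singleton (x := e))
      isOpen_univ (Set.subset_univ _)
    have h1 := G.actionOf_toX ψ g x
    rw [h] at h1
    have h2 : G.toFunction (G.toX (mulComp ψ g x)) e = 0 := by
      rw [← h1]
      change G.toFunction 0 e = 0
      simp
    rw [toFunction_toX] at h2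
    simpa [mulComp_apply, hx] using h2
  · intro h
    refine Subtype.ext (ContinuousLinearMap.ext fun x => ?_)
    induction x using G.induction_toX with
    | hp => exact isClosed_eq (G.actionOf ψ g).1.continuous continuous_const
    | h x =>
      rw [actionOf_toX]
      have : mulComp ψ g x = 0 := by ext e; simp [mulComp_apply, h]
      rw [this, map_zero]; rfl

theorem toFunction_actionOf (ψ : C(E, W)) (g : C₀(W, ℂ)) (x : C_c(E, ℂ)) (e : E) :
    G.toFunction ((G.actionOf ψ g).1 (G.toX x)) e = g (ψ e) * x e := by
  rw [actionOf_toX, toFunction_toX]; rfl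

/-- If `g ∘ ψ` acts as a compact operator, then it vanishes at infinity. -/
theorem exists_compact_norm_le_of_actionOf_mem_compacts (ψ : C(E, W)) {g : C₀(W, ℂ)}
    (hg : G.actionOf ψ g ∈ Adjointable.compacts C₀(V, ℂ) G.X) {ε : ℝ} (hε : 0 < ε) :
    ∃ K : Set E, IsCompact K ∧ ∀ e ∉ K, ‖g (ψ e)‖ ≤ ε := by
  obtain ⟨K, hK, h⟩ := G.exists_compact_of_mem_compacts hg hε
  refine ⟨K, hK, fun e he => ?_⟩
  obtain ⟨U, hU, heU, hi⟩ := G.isLocalHomeomorph_s.isLocallyInjective e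
  -- The test vector is 1 at `e` and lives where `s` is injective, so its module norm is at most 1
  -- and the bound on the operator becomes a bound on `g (ψ e)`.
  obtain ⟨x, hx1, hxU, hx⟩ := CompactlySupportedContinuousMap.exists_eq_one
    (isCompact_singleton (x := e)) hU (Set.singleton_subset_iff.2 heU)
  have h1 := h e he (G.toX x)
  rw [toFunction_actionOf, hx1 e rfl, mul_one] at h1
  have h2 := G.norm_toX_le_of_injOn (x := x)
    (fun a b ha hb hab => hi (hxU a ha) (hxU b hb) hab) hx
  exact h1.trans (mul_le_of_le_one_right hε.le h2)

/-- If `g ∘ ψ` has compact support, then it acts as a compact operator. -/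
theorem actionOf_mem_compacts_of_hasCompactSupport (ψ : C(E, W)) {g : C₀(W, ℂ)}
    (hg : HasCompactSupport (g ∘ ψ)) :
    G.actionOf ψ g ∈ Adjointable.compacts C₀(V, ℂ) G.X := by
  obtain ⟨n, u, ξ, hsum, huξ, hξ⟩ := G.isLocalHomeomorph_s.exists_decomposition 
    ⟨⟨g ∘ ψ, (map_continuous g).comp ψ.continuous⟩, hg⟩
  have key : G.actionOf ψ g = ∑ i, rankOne (G.toX (u i)) (G.toX (ξ i)) := by
    refine Subtype.ext (ContinuousLinearMap.ext fun z => ?_)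
    induction z using G.induction_toX with
    | hp => exact isClosed_eq (ContinuousLinearMap.continuous _) (ContinuousLinearMap.continuous _)
    | h z =>
      have h1 : (∑ i, rankOne (A := C₀(V, ℂ)) (G.toX (u i)) (G.toX (ξ i))).1 (G.toX z)
          = G.toX (∑ i, G.preModule.act (u i) (G.fiberSum (star (ξ i) * z))) := by
        rw [AddSubmonoidClass.coe_finsetSum, sum_apply, map_sum]
        refine Finset.sum_congr rfl fun i _ => ?_
        rw [rankOne_apply, ip_toX, act_toX]
      rw [actionOf_toX, h1]
      congr 1
      ext e
      rw [CompactlySupportedContinuousMap.sum_apply]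
      have h2 : g (ψ e) = ∑ i, u i e := by
        rw [← CompactlySupportedContinuousMap.sum_apply, ← hsum]; rfl
      rw [mulComp_apply, h2, Finset.sum_mul]
      refine Finset.sum_congr rfl fun i _ => ?_
      rw [preModule_act_apply]
      by_cases hu : u i e = 0
      · simp [hu]
      -- Where `u i` is nonzero the cut-off is 1, and the fibre sum collapses to the single term at
      -- `e`. The `i`-th rank-one operator is thus multiplication by `u i`.
      have h3 : ξ i e = 1 := by
        have := DFunLike.congr_fun (huξ i) e
        rw [CompactlySupportedContinuousMap.mul_apply] at this
        exact mul_left_cancel₀ hu (this.trans (mul_one _).symm)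
      rw [G.fiberSum_apply_source_of_injOn (hξ i) _ (fun e he => by simp [he]) (by simp [h3])]
      simp [h3, mul_comm]
  rw [key]
  exact sum_mem fun i _ => Submodule.le_topologicalClosure _ (Submodule.subset_span
    ⟨_, _, fun z => rankOne_apply _ _ z⟩)

/-- The ideal `J_ψ` consists of the functions which vanish on the `ψ`-singular points. -/
theorem mem_covarianceIdeal_actionOf [T2Space W] [LocallyCompactSpace W] (ψ : C(E, W))
    {g : C₀(W, ℂ)} :
    g ∈ covarianceIdeal (G.actionOf ψ) ↔ ∀ w ∈ singularSet ψ, g w = 0 := by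
  constructor
  · rintro ⟨hc, hk⟩ w hw
    -- A bump at a source, supported off the closure of the range of `ψ`, lies in the kernel, so `g`
    -- annihilates it.
    have hsrc : ∀ w ∈ sourceSet ψ, g w = 0 := by
      intro w hw
      obtain ⟨c, hc1, hcU, -⟩ := CompactlySupportedContinuousMap.exists_eq_one
        (isCompact_singleton (x := w)) isClosed_closure.isOpen_compl
        (Set.singleton_subset_iff.2 hw)
      have h := hk c.toZeroAtInfty <| (G.actionOf_eq_zero_iff ψ _).2 fun e => by
        by_contra hne
        exact hcU _ hne (subset_closure ⟨e, rfl⟩)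
      simpa [hc1] using DFunLike.congr_fun h w
    have hcl : closure (sourceSet ψ) ⊆ {w | g w = 0} :=
      closure_minimal hsrc (isClosed_eq (map_continuous g) continuous_const)
    by_contra hne
    -- If `g w ≠ 0`, then `w` is outside the closure of the sources, and the set where `‖g‖` exceeds
    -- half of `‖g w‖` will show that it is a finite receiver. This contradicts singularity.
    refine hw ⟨?_, fun h => hne (hcl h)⟩
    have hpos : 0 < ‖g w‖ / 2 := half_pos (norm_pos_iff.2 hne)
    have hcle : IsClosed {w' | ‖g w‖ / 2 ≤ ‖g w'‖} :=
      isClosed_le continuous_const (map_continuous g).norm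
    have hsub : closure {w' | ‖g w‖ / 2 < ‖g w'‖} ⊆ {w' | ‖g w‖ / 2 ≤ ‖g w'‖} :=
      closure_minimal (Set.ofPred_subset_ofPred.2 fun w' h => h.le) hcle
    refine ⟨{w' | ‖g w‖ / 2 < ‖g w'‖}, isOpen_lt continuous_const (map_continuous g).norm,
      half_lt_self (norm_pos_iff.2 hne),
      (g.isCompact_le_norm hpos).of_isClosed_subset isClosed_closure hsub, ?_⟩
    -- Off `K` the values of `g ∘ ψ` are at most a quarter of `‖g w‖`, while on the preimage of the
    -- closed neighbourhood they are at least half, so that preimage lies in `K`.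
    obtain ⟨K, hK, hKg⟩ :=
      G.exists_compact_norm_le_of_actionOf_mem_compacts ψ hc (half_pos hpos)
    refine hK.of_isClosed_subset (isClosed_closure.preimage ψ.continuous) fun e he => ?_
    by_contra heK
    have h1 : ‖g w‖ / 2 ≤ ‖g (ψ e)‖ := hsub he
    linarith [hKg e heK]
  · intro h
    refine ⟨?_, fun c hc => ?_⟩
    · have hcl : IsClosed (Adjointable.compacts C₀(V, ℂ) G.X : Set (Adjointable C₀(V, ℂ) G.X)) :=
        Submodule.isClosed_topologicalClosure _
      refine hcl.closure_subset (Metric.mem_closure_iff.2 fun ε hε => ?_)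
      have hε2 : 0 < ε / 2 := half_pos hε
      -- Points with `‖g‖ ≥ ε / 2` are regular, hence finite receivers, so the threshold composed
      -- with `ψ` has compact support and acts compactly.
      refine ⟨G.actionOf ψ (g.softThreshold hε2), ?_, ?_⟩
      · refine G.actionOf_mem_compacts_of_hasCompactSupport ψ
          (g.hasCompactSupport_softThreshold_comp hε2 ψ.continuous
            (isCompact_preimage_of_subset_finiteReceiverSet ψ.continuous
              (g.isCompact_le_norm hε2) fun w hw => ?_))
        by_contra hfin
        have h0 : g w = 0 := h w fun hr => hfin hr.1
        rw [Set.mem_ofPred_eq, h0, norm_zero] at hw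
        linarith
      · have h1 := (G.norm_actionOf_le ψ _).trans (g.norm_sub_softThreshold_le hε2)
        rw [map_sub] at h1
        rw [dist_eq_norm]
        exact h1.trans_lt (half_lt_self hε)
    · rw [actionOf_eq_zero_iff] at hc
      ext w
      rw [ZeroAtInftyContinuousMap.mul_apply, ZeroAtInftyContinuousMap.zero_apply, mul_eq_zero]
      -- On the closure of the range `c` vanishes by continuity; every other point is a source,
      -- hence singular, and there `g` vanishes.
      by_cases hw : w ∈ closure (Set.range ψ)
      · right
        exact closure_minimal (s := Set.range ψ) (t := {w | c w = 0})
          (by rintro _ ⟨e, rfl⟩; exact hc e)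
          (isClosed_eq (map_continuous c) continuous_const) hw
      · exact .inl (h w fun hr => hr.2 (subset_closure hw))

end Correspondence

end TopologicalGraph

/-! ### The in-split conditions for `C₀(V) → C₀(W)`. -/

namespace TopologicalGraph

section Correspondence

variable {V E : Type*} [TopologicalSpace V] [TopologicalSpace E]
  [T2Space V] [T2Space E] [LocallyCompactSpace V] [LocallyCompactSpace E]
  (G : TopologicalGraph V E)

/-- A cut-off equal to 1 on the image under `r` of the support of `x` acts on `x` as the identity.
-/
theorem isNondegenerateAction_leftAction : IsNondegenerateAction G.leftAction := by
  refine Submodule.dense_iff_topologicalClosure_eq_top.1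
    (G.preModule.denseRange_ι.mono ?_)
  rintro _ ⟨x, rfl⟩
  obtain ⟨b, hb, -⟩ := CompactlySupportedContinuousMap.exists_eq_one
    (x.hasCompactSupport.isCompact.image G.r.continuous) isOpen_univ (Set.subset_univ _)
  refine Submodule.subset_span ⟨b.toZeroAtInfty, G.toX x, ?_⟩
  have h := G.actionOf_toX G.r b.toZeroAtInfty x
  refine Eq.trans ?_ h.symm
  refine congrArg G.toX ?_
  ext e
  rw [mulComp_apply, CompactlySupportedContinuousMap.toZeroAtInfty_apply]
  by_cases he : x e = 0
  · simp [he]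
  · rw [hb _ ⟨e, subset_tsupport _ he, rfl⟩, one_mul]

end Correspondence

namespace InSplit

variable {V E W : Type*} [TopologicalSpace V] [TopologicalSpace E] [TopologicalSpace W]
  {G : TopologicalGraph V E} (I : G.InSplit W)

/-- The `*`-homomorphism `f ↦ f ∘ α`. -/
noncomputable def pullback : C₀(V, ℂ) →⋆ₙₐ[ℂ] C₀(W, ℂ) where
  toFun f := ⟨f.1.comp I.α, f.zero_at_infty'.comp <|
    (Filter.hasBasis_cocompact.tendsto_iff Filter.hasBasis_cocompact).2 fun _ hK =>
      ⟨_, I.isProperMap_α.isCompact_preimage hK, fun _ hw => hw⟩⟩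
  map_smul' _ _ := rfl
  map_zero' := rfl
  map_add' _ _ := rfl
  map_mul' _ _ := rfl
  map_star' _ := rfl

@[simp]
theorem pullback_apply (f : C₀(V, ℂ)) (w : W) : I.pullback f w = f (I.α w) := rfl

theorem pullback_injective : Function.Injective I.pullback := fun f g h => by
  ext v
  obtain ⟨w, rfl⟩ := I.surjective_α v
  exact DFunLike.congr_fun h w

theorem isNondegenerateHom_pullback [T2Space V] [LocallyCompactSpace V] :
    IsNondegenerateHom I.pullback := by
  refine Submodule.dense_iff_topologicalClosure_eq_top.1
    (CompactlySupportedContinuousMap.denseRange_toZeroAtInfty.mono ?_)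
  rintro _ ⟨g, rfl⟩
  obtain ⟨a, ha, -⟩ := CompactlySupportedContinuousMap.exists_eq_one
    (g.hasCompactSupport.isCompact.image I.α.continuous) isOpen_univ (Set.subset_univ _)
  refine Submodule.subset_span ⟨a.toZeroAtInfty, g.toZeroAtInfty, ?_⟩
  ext w
  rw [ZeroAtInftyContinuousMap.mul_apply, pullback_apply]
  simp only [CompactlySupportedContinuousMap.toZeroAtInfty_apply]
  by_cases hw : g w = 0
  · simp [hw]
  · rw [ha _ ⟨w, subset_tsupport _ hw, rfl⟩, one_mul]

theorem isInSplit [T2Space V] [LocallyCompactSpace V] [T2Space E] [LocallyCompactSpace E]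
    [T2Space W] [LocallyCompactSpace W] :
    IsInSplit G.leftAction I.pullback (G.actionOf I.ψ) := by
  obtain ⟨h, hh⟩ := I.singular_homeomorph
  have hideal : covarianceIdeal G.leftAction ≤
      (covarianceIdeal (G.actionOf I.ψ)).comap (LinearMapClass.linearMap I.pullback) := by
    intro f hf
    have hf := (G.mem_covarianceIdeal_actionOf G.r).1 hf
    refine (G.mem_covarianceIdeal_actionOf I.ψ).2 fun w hw => ?_
    have := hf _ (h ⟨w, hw⟩).2
    rwa [hh] at this
  refine ⟨G.isNondegenerateAction_leftAction, I.isNondegenerateHom_pullback,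
    I.pullback_injective, ?_, hideal, ?_, ?_⟩
  · ext f : 1
    refine Subtype.ext (ContinuousLinearMap.ext fun x => ?_)
    induction x using G.induction_toX with
    | hp => exact isClosed_eq (ContinuousLinearMap.continuous _) (ContinuousLinearMap.continuous _)
    | h x =>
      refine (G.actionOf_toX I.ψ (I.pullback f) x).trans
        (Eq.trans ?_ (G.actionOf_toX G.r f x).symm)
      congr 1
      ext e
      rw [mulComp_apply, mulComp_apply, pullback_apply, I.α_ψ]
  · refine (injective_iff_map_eq_zero _).2 fun f hf => ?_
    obtain ⟨f, rfl⟩ := Submodule.Quotient.mk_surjective _ f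
    rw [Submodule.mapQ_apply, Submodule.Quotient.mk_eq_zero, mem_covarianceIdeal_actionOf] at hf
    refine (Submodule.Quotient.mk_eq_zero _).2
      ((G.mem_covarianceIdeal_actionOf G.r).2 fun v hv => ?_)
    obtain ⟨w, hw⟩ := h.surjective ⟨v, hv⟩
    have h1 : f (I.α w) = 0 := hf w w.2
    rwa [← hh, hw] at h1
  -- Surjectivity: `g` is moved to the singular set of `r` along `h.symm` and extended to `V`. The
  -- pullback of the extension differs from `g` by a function vanishing on the `ψ`-singular set,
  -- hence by an element of `J_ψ`.
  · intro g
    obtain ⟨g, rfl⟩ := Submodule.Quotient.mk_surjective _ g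
    have hcl := isClosed_singularSet I.ψ
    have he : Topology.IsClosedEmbedding fun w : singularSet G.r => (w : V) :=
      (isClosed_singularSet G.r).isClosedEmbedding_subtypeVal
    let g' : C₀(singularSet G.r, ℂ) :=
      ⟨g.1.comp ⟨fun v => ((h.symm v : singularSet I.ψ) : W), by fun_prop⟩,
        g.zero_at_infty'.comp
          (hcl.isClosedEmbedding_subtypeVal.comp h.symm.isClosedEmbedding).tendsto_cocompact⟩
    obtain ⟨f, hf⟩ := ZeroAtInftyContinuousMap.exists_extension he g'
    refine ⟨Submodule.Quotient.mk f, ?_⟩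
    rw [Submodule.mapQ_apply, Submodule.Quotient.eq, mem_covarianceIdeal_actionOf]
    intro w hw
    have h1 := hf (h ⟨w, hw⟩)
    have h2 : g' (h ⟨w, hw⟩) = g w := by
      change g (h.symm (h ⟨w, hw⟩) : singularSet I.ψ) = g w
      rw [h.symm_apply_apply]
    rw [h2, hh] at h1
    exact sub_eq_zero.2 h1

end InSplit

end TopologicalGraph

/-! ### Isometries out of the interior tensor product. -/

namespace HilbertModule

section

variable {A X : Type*} [NonUnitalCStarAlgebra A] [NormedAddCommGroup X] [NormedSpace ℂ X]
  [HilbertModule A X]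

theorem continuous_ip {Z : Type*} [TopologicalSpace Z] {f g : Z → X} (hf : Continuous f)
    (hg : Continuous g) : Continuous fun z => ip A (f z) (g z) :=
  (((toPre (A := A) (X := X)).ip.mkContinuous₂ 1 fun x y => by
    rw [one_mul]; exact norm_ip_le x y).continuous.comp hf).clm_apply hg

theorem norm_eq_of_ip_eq {B Y : Type*} [NonUnitalCStarAlgebra B] [NormedAddCommGroup Y]
    [NormedSpace ℂ Y] [HilbertModule B Y] {x : X} {y : Y} (h : ‖ip A x x‖ = ‖ip B y y‖) :
    ‖x‖ = ‖y‖ := by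
  rw [← norm_sq, ← norm_sq] at h
  exact (pow_left_inj₀ (norm_nonneg _) (norm_nonneg _) two_ne_zero).1 h

end

variable {A B V Y : Type*} [NonUnitalCStarAlgebra A] [NonUnitalCStarAlgebra B] [AddCommGroup V]
  [Module ℂ V] {P : PreHilbertModule A V} [NormedAddCommGroup Y] [NormedSpace ℂ Y]
  [HilbertModule B Y] {α : A →⋆ₙₐ[ℂ] B}

/-- A bilinear map `T : V × B → Y` with `(T(x, b) ∣ T(y, c)) = b* α((x ∣ y)) c` extends to the
completion of `V`. -/
theorem exists_extension_left (T : V →ₗ[ℂ] B →ₗ[ℂ] Y)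
    (hT : ∀ x b y c, ip B (T x b) (T y c) = star b * α (P.ip x y) * c) :
    ∃ T' : P.Completion →ₗ[ℂ] B →ₗ[ℂ] Y, (∀ x b, T' (P.ι x) b = T x b) ∧
      (∀ b, Continuous fun x => T' x b) ∧
      ∀ x b y c, ip B (T' x b) (T' y c) = star b * α (ip A x y) * c := by
  have := complete (A := B) (X := Y)
  have hα : Continuous α := AddMonoidHomClass.continuous_of_bound α 1 fun a => by
    rw [one_mul]; exact NonUnitalStarAlgHom.norm_apply_le α a
  have hbound : ∀ b x, ‖T.flip b x‖ ≤ ‖b‖ * ‖P.ι x‖ := by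
    intro b x
    refine le_of_sq_le_sq ?_ (by positivity)
    rw [norm_sq (A := B), mul_pow, P.norm_ι_sq, LinearMap.flip_apply]
    change ‖ip B (T x b) (T x b)‖ ≤ _
    rw [hT]
    calc ‖star b * α (P.ip x x) * b‖ ≤ ‖star b‖ * ‖P.ip x x‖ * ‖b‖ :=
          (norm_mul_le _ _).trans (by
            gcongr
            refine (norm_mul_le _ _).trans ?_
            gcongr
            exact NonUnitalStarAlgHom.norm_apply_le α _)
      _ = ‖b‖ ^ 2 * ‖P.ip x x‖ := by rw [norm_star]; ring
  -- The extension is made in the first variable only, separately for each `b`; linearity in `b`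
  -- follows by density.
  let F : B → P.Completion →L[ℂ] Y := fun b => (T.flip b).extendOfNorm P.ι
  have hF : ∀ b x, F b (P.ι x) = T x b := fun b x =>
    LinearMap.extendOfNorm_eq P.denseRange_ι ⟨_, hbound b⟩ x
  refine ⟨LinearMap.mk₂ ℂ (fun x b => F b x) (fun x y b => map_add _ _ _)
    (fun t x b => map_smul _ _ _) (fun x b c => ?_) (fun t x b => ?_), fun x b => hF b x,
    fun b => (F b).continuous, ?_⟩
  · induction x using P.induction_ι with
    | hp => exact isClosed_eq (by fun_prop) (by fun_prop)
    | h x => simp only [hF, map_add]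
  · induction x using P.induction_ι with
    | hp => exact isClosed_eq (by fun_prop) (by fun_prop)
    | h x => simp only [hF, map_smul]
  · intro x b y c
    simp only [LinearMap.mk₂_apply]
    induction x using P.induction_ι with
    | hp =>
      exact isClosed_eq (continuous_ip (F b).continuous continuous_const)
        ((continuous_const.mul (hα.comp (continuous_ip continuous_id continuous_const))).mul
          continuous_const)
    | h x =>
      induction y using P.induction_ι with
      | hp =>
        exact isClosed_eq (continuous_ip continuous_const (F c).continuous)
          ((continuous_const.mul (hα.comp (continuous_ip continuous_const continuous_id))).mul
            continuous_const)
      | h y =>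
        rw [hF, hF, hT]
        congr 3
        exact (P.ipCompletion_ι x y).symm

/-- A bilinear map `T : X × B → Y` with `(T(x, b) ∣ T(y, c)) = b* α((x ∣ y)) c` induces an isometry
on the interior tensor product. -/
theorem exists_tensor_lift {X : Type*} [NormedAddCommGroup X] [NormedSpace ℂ X] [HilbertModule A X]
    (T : X →ₗ[ℂ] B →ₗ[ℂ] Y) (hT : ∀ x b y c, ip B (T x b) (T y c) = star b * α (ip A x y) * c) :
    ∃ β : Tensor X α →L[ℂ] Y, (∀ x b, β (tmul α x b) = T x b) ∧
      ∀ z w, ip B (β z) (β w) = ip B z w := by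
  have := complete (A := B) (X := Y)
  let L := TensorProduct.lift T
  have hL : ∀ z w, ip B (L z) (L w) = (tensorPre X α).ip z w := by
    intro z w
    change ip B (L z) (L w) = tensorIp X α z w
    induction z with
    | zero => simp [ip]
    | tmul x b =>
      induction w with
      | zero => simp [ip]
      | tmul y c => rw [tensorIp_tmul]; exact hT x b y c
      | add z w hz hw => simp only [ip, map_add] at hz hw ⊢; rw [hz, hw]
    | add z w hz hw =>
      simp only [ip, map_add, LinearMap.add_apply] at hz hw ⊢; rw [hz, hw]
  have hb : ∀ z, ‖L z‖ ≤ 1 * ‖(tensorPre X α).ι z‖ := by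
    intro z
    refine le_of_sq_le_sq ?_ (by positivity)
    rw [one_mul, norm_sq (A := B), (tensorPre X α).norm_ι_sq, ← hL]
  have hβ := LinearMap.extendOfNorm_eq (tensorPre X α).denseRange_ι ⟨1, hb⟩
  refine ⟨L.extendOfNorm (tensorPre X α).ι, fun x b => hβ _, fun z w => ?_⟩
  induction z using (tensorPre X α).induction_ι with
  | hp =>
    exact isClosed_eq (continuous_ip (ContinuousLinearMap.continuous _) continuous_const)
      (continuous_ip continuous_id continuous_const)
  | h z =>
    induction w using (tensorPre X α).induction_ι with
    | hp =>
      exact isClosed_eq (continuous_ip continuous_const (ContinuousLinearMap.continuous _))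
        (continuous_ip continuous_const continuous_id)
    | h w =>
      rw [hβ, hβ, hL]
      exact ((tensorPre X α).ipCompletion_ι z w).symm

end HilbertModule

/-! ### The isomorphism with the correspondence of the in-split graph. -/

namespace TopologicalGraph

namespace InSplit

variable {V E W : Type*} [TopologicalSpace V] [TopologicalSpace E] [TopologicalSpace W]
  [T2Space V] {G : TopologicalGraph V E} (I : G.InSplit W)

theorem isClosedEmbedding_val :
    Topology.IsClosedEmbedding (Subtype.val : I.Edge → E × W) :=
  (isClosed_eq (G.isLocalHomeomorph_s.continuous.comp continuous_fst)
    (I.α.continuous.comp continuous_snd)).isClosedEmbedding_subtypeVal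

/-- The function `(e, w) ↦ x(e) b(w)` on the edge space of the in-split graph. -/
noncomputable def edgeProd (x : C_c(E, ℂ)) (b : C₀(W, ℂ)) : C_c(I.Edge, ℂ) where
  toFun p := x p.1.1 * b p.1.2
  continuous_toFun :=
    ((map_continuous x).comp (continuous_fst.comp continuous_subtype_val)).mul
      ((map_continuous b).comp (continuous_snd.comp continuous_subtype_val))
  hasCompactSupport' := by
    -- `b` need not have compact support: `s(e) = α(w)` confines `w` to the preimage under `α` of a
    -- compact set, which is compact because `α` is proper.
    have hK : IsCompact (tsupport x ×ˢ (I.α ⁻¹' (G.s '' tsupport x))) :=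
      x.hasCompactSupport.isCompact.prod (I.isProperMap_α.isCompact_preimage
        (x.hasCompactSupport.isCompact.image G.isLocalHomeomorph_s.continuous))
    have hcl : IsClosed (tsupport x ×ˢ (I.α ⁻¹' (G.s '' tsupport x))) :=
      (isClosed_tsupport x).prod ((x.hasCompactSupport.isCompact.image
        G.isLocalHomeomorph_s.continuous).isClosed.preimage I.α.continuous)
    refine HasCompactSupport.intro' (I.isClosedEmbedding_val.isCompact_preimage hK)
      (hcl.preimage continuous_subtype_val) fun p hp => ?_
    by_contra hne
    have h1 : p.1.1 ∈ tsupport x := subset_tsupport x (left_ne_zero_of_mul hne)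
    exact hp ⟨h1, p.1.1, h1, p.2⟩

theorem edgeProd_apply (x : C_c(E, ℂ)) (b : C₀(W, ℂ)) (p : I.Edge) :
    I.edgeProd x b p = x p.1.1 * b p.1.2 := rfl

variable [T2Space E] [T2Space W] [LocallyCompactSpace E] [LocallyCompactSpace W]

/-- The map `e ↦ (e, w)` identifies the fibre of `s` over `α(w)` with the fibre of the in-split
graph over `w`, and on it the factors depending on `w` are constant. -/
theorem fiberSum_edgeProd (x y : C_c(E, ℂ)) (b c : C₀(W, ℂ)) :
    I.graph.fiberSum (star (I.edgeProd x b) * I.edgeProd y c) =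
      star b * I.pullback (G.fiberSum (star x * y)) * c := by
  ext w
  obtain ⟨t, hts, ht⟩ := G.exists_finset x.hasCompactSupport.isCompact (I.α w)
  have hne : ∀ e, x e ≠ 0 → e ∈ tsupport x := fun e he => subset_tsupport x he
  let j : t ↪ I.Edge := ⟨fun e => ⟨(e.1, w), hts e.1 e.2⟩, fun e e' h =>
    Subtype.ext (congrArg (fun p : I.Edge => p.1.1) h)⟩
  rw [I.graph.fiberSum_eq_sum _ w (t := t.attach.map j)]
  · rw [ZeroAtInftyContinuousMap.mul_apply, ZeroAtInftyContinuousMap.mul_apply, pullback_apply,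
      G.fiberSum_eq_sum _ _ hts fun e he h => ht e he (hne e fun h0 => h (by simp [h0])),
      Finset.sum_map, ← Finset.sum_attach t, Finset.mul_sum, Finset.sum_mul]
    refine Finset.sum_congr rfl fun e _ => ?_
    change star (x e * b w) * (y e * c w) = star (b w) * (star (x e) * y e) * c w
    rw [star_mul']
    ring
  · intro p hp
    obtain ⟨e, -, rfl⟩ := Finset.mem_map.1 hp
    rfl
  · intro p hp h
    have hp : p.1.2 = w := hp
    have he : p.1.1 ∈ t := ht _ (p.2.trans (congrArg I.α hp))
      (hne _ fun h0 => h (by simp [edgeProd_apply, h0]))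
    exact Finset.mem_map.2 ⟨⟨p.1.1, he⟩, Finset.mem_attach _ _,
      Subtype.ext (Prod.ext rfl hp.symm)⟩

/-- The bilinear map `(x, b) ↦ ((e, w) ↦ x(e) b(w))` into `X(E_I)`. -/
noncomputable def edgeProdToX : C_c(E, ℂ) →ₗ[ℂ] C₀(W, ℂ) →ₗ[ℂ] I.graph.X :=
  (LinearMap.mk₂ ℂ I.edgeProd
    (fun x y b => by ext p; simp [edgeProd_apply, add_mul])
    (fun t x b => by ext p; simp [edgeProd_apply, mul_assoc])
    (fun x b c => by ext p; simp [edgeProd_apply, mul_add])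
    (fun t x b => by ext p; simp [edgeProd_apply, mul_left_comm])).compr₂ I.graph.toX

theorem edgeProdToX_apply (x : C_c(E, ℂ)) (b : C₀(W, ℂ)) :
    I.edgeProdToX x b = I.graph.toX (I.edgeProd x b) := rfl

/-- Where `ξ i` is nonzero an edge `(e, w)` is determined by `w`, so `u i (e) F(e, w)` can be read
off from its fibre sum at `w`. This separates the variables exactly, without approximation. -/
theorem exists_eq_sum_edgeProd (F : C_c(I.Edge, ℂ)) :
    ∃ (n : ℕ) (x : Fin n → C_c(E, ℂ)) (b : Fin n → C₀(W, ℂ)),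
      F = ∑ i, I.edgeProd (x i) (b i) := by
  have hfst : Continuous fun p : I.Edge => p.1.1 := continuous_fst.comp continuous_subtype_val
  obtain ⟨h, h1, -⟩ := CompactlySupportedContinuousMap.exists_eq_one
    (F.hasCompactSupport.isCompact.image hfst) isOpen_univ (Set.subset_univ _)
  obtain ⟨n, u, ξ, hsum, huξ, hξ⟩ := G.isLocalHomeomorph_s.exists_decomposition h
  let f : Fin n → C_c(I.Edge, ℂ) := fun i =>
    ⟨⟨fun p => u i p.1.1 * F p, ((map_continuous (u i)).comp hfst).mul (map_continuous F)⟩,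
      F.hasCompactSupport.mul_left⟩
  have hf : ∀ i p, f i p = u i p.1.1 * F p := fun _ _ => rfl
  refine ⟨n, ξ, fun i => I.graph.fiberSum (f i), ?_⟩
  ext p
  have hF : F p = h p.1.1 * F p := by
    by_cases hp : F p = 0
    · simp [hp]
    · rw [h1 _ ⟨p, subset_tsupport _ hp, rfl⟩, one_mul]
  rw [hF, hsum, CompactlySupportedContinuousMap.sum_apply,
    CompactlySupportedContinuousMap.sum_apply, Finset.sum_mul]
  refine Finset.sum_congr rfl fun i _ => ?_
  have hu : ∀ e, u i e * ξ i e = u i e := fun e => DFunLike.congr_fun (huξ i) e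
  rw [edgeProd_apply, ← hf]
  by_cases hp : ξ i p.1.1 = 0
  · rw [hp, zero_mul, hf, ← hu, hp, mul_zero, zero_mul]
  · have h2 : I.graph.fiberSum (f i) (I.graph.s p) = f i p := by
      refine I.graph.fiberSum_apply_source_of_injOn (ξ := fun q : I.Edge => ξ i q.1.1)
        (fun q q' hq hq' hqq => ?_) _ (fun q hq => ?_) hp
      · have hqq : q.1.2 = q'.1.2 := hqq
        exact Subtype.ext (Prod.ext (hξ i _ _ hq hq' (by rw [q.2, q'.2, hqq])) hqq)
      · have hq : ξ i q.1.1 = 0 := hq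
        rw [hf, ← hu, hq, mul_zero, zero_mul]
    change f i p = ξ i p.1.1 * I.graph.fiberSum (f i) (I.graph.s p)
    rw [h2, hf, ← mul_assoc, mul_comm (ξ i _), hu]

theorem exists_tensor_isomorphism :
    ∃ β : Tensor G.X I.pullback →ₗ[ℂ] I.graph.X, Function.Bijective β ∧
      IsCorrespondenceMorphism (tensorAction I.pullback (G.actionOf I.ψ)) I.graph.leftAction
        (NonUnitalStarAlgHom.id ℂ C₀(W, ℂ)) β := by
  obtain ⟨T, hT, hTc, hTip⟩ := exists_extension_left (P := G.preModule) (α := I.pullback)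
    I.edgeProdToX fun x b y c => by
      rw [edgeProdToX_apply, edgeProdToX_apply, ip_toX, fiberSum_edgeProd]; rfl
  obtain ⟨β, hβ, hip⟩ := exists_tensor_lift T hTip
  have hβι : ∀ x b, β (tmul I.pullback (G.toX x) b) = I.graph.toX (I.edgeProd x b) :=
    fun x b => (hβ _ b).trans (hT x b)
  have hiso : Isometry β := AddMonoidHomClass.isometry_of_norm β fun z =>
    norm_eq_of_ip_eq (A := C₀(W, ℂ)) (B := C₀(W, ℂ)) (by rw [hip])
  have hsurj : Function.Surjective β := by
    -- An isometry on a complete space has closed range, so density of the range suffices.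
    rw [← Set.range_eq_univ, ← hiso.isClosedEmbedding.isClosed_range.closure_eq]
    refine DenseRange.closure_range (I.graph.preModule.denseRange_ι.mono ?_)
    rintro _ ⟨F, rfl⟩
    obtain ⟨n, x, b, rfl⟩ := I.exists_eq_sum_edgeProd F
    refine ⟨∑ i, tmul I.pullback (G.toX (x i)) (b i), ?_⟩
    rw [map_sum, map_sum]
    exact Finset.sum_congr rfl fun i _ => hβι _ _
  refine ⟨β, ⟨hiso.injective, hsurj⟩, hip, fun x a => ?_, fun a z => ?_⟩
  -- Right linearity is automatic: both sides have the same inner product with every `β z`, and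
  -- these are all vectors.
  · refine ext_ip C₀(W, ℂ) fun z => ?_
    obtain ⟨z, rfl⟩ := hsurj z
    change ip _ (β z) (β (act x a)) = ip _ (β z) (act (β x) a)
    simp only [ip, act, PreHilbertModule.ip_act]
    change ip _ (β z) (β (act x a)) = ip _ (β z) (β x) * a
    rw [hip, hip, ip, PreHilbertModule.ip_act]
  · change β ((tensorAction I.pullback (G.actionOf I.ψ) a).1 z) =
      (I.graph.actionOf I.graph.r a).1 (β z)
    -- Two density arguments: reduction to elementary tensors `x ⊗ b`, then to `x ∈ C_c(E)`, where
    -- both sides are given by the same function on edges.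
    induction z using (tensorPre G.X I.pullback).induction_ι with
    | hp =>
      exact isClosed_eq (β.continuous.comp (ContinuousLinearMap.continuous _))
        ((ContinuousLinearMap.continuous _).comp β.continuous)
    | h z =>
      induction z with
      | zero => simp only [map_zero]
      | add z w hz hw => simp only [map_add, hz, hw]
      | tmul x b =>
        change β ((tensorAction I.pullback (G.actionOf I.ψ) a).1 (tmul I.pullback x b)) =
          (I.graph.actionOf I.graph.r a).1 (β (tmul I.pullback x b))
        rw [tensorAction_tmul, hβ, hβ]
        induction x using G.induction_toX with
        | hp =>
          exact isClosed_eq ((hTc b).comp (ContinuousLinearMap.continuous _))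
            ((ContinuousLinearMap.continuous _).comp (hTc b))
        | h x =>
          rw [← hβ, ← hβ, actionOf_toX, hβι, hβι, actionOf_toX]
          congr 1
          ext p
          rw [mulComp_apply, edgeProd_apply, edgeProd_apply, mulComp_apply, mul_assoc]
          rfl

end InSplit

end TopologicalGraph

theorem mainTheorem6 {V E W : Type*}
    [TopologicalSpace V] [T2Space V] [LocallyCompactSpace V] [SecondCountableTopology V]
    [TopologicalSpace E] [T2Space E] [LocallyCompactSpace E] [SecondCountableTopology E]
    [TopologicalSpace W] [T2Space W] [LocallyCompactSpace W]
    (G : TopologicalGraph V E) (I : G.InSplit W) :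
    ∃ (αs : C₀(V, ℂ) →⋆ₙₐ[ℂ] C₀(W, ℂ))
      (ψs : C₀(W, ℂ) →⋆ₙₐ[ℂ] HilbertModule.Adjointable C₀(V, ℂ) G.X),
      (∀ f w, αs f w = f (I.α w)) ∧
      (∀ (f : C₀(W, ℂ)) (x y : C_c(E, ℂ)), (∀ e, y e = f (I.ψ e) * x e) →
        (ψs f).1 (G.toX x) = G.toX y) ∧
      IsInSplit G.leftAction αs ψs ∧
      ∃ β : HilbertModule.Tensor G.X αs →ₗ[ℂ] I.graph.X,
        Function.Bijective β ∧
        IsCorrespondenceMorphism (HilbertModule.tensorAction αs ψs) I.graph.leftAction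
          (NonUnitalStarAlgHom.id ℂ C₀(W, ℂ)) β := by
  refine ⟨I.pullback, G.actionOf I.ψ, fun _ _ => rfl, fun f x y h => ?_, I.isInSplit,
    I.exists_tensor_isomorphism⟩
  rw [TopologicalGraph.actionOf_toX]
  congr 1
  ext e
  exact (h e).symm
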